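/- **Notation.** For $h\in(0,1)$ and an integer $k\ge 0$ put $\|u\|_{H^k_h(\mathbb R^3)}=\big(\sum_{|\alpha|\le k}\int_{\mathbb R^3}|(h\partial_x)^\alpha u|^2\,dx\big)^{1/2}$; for an integer $k>0$, $\|\cdot\|_{H^{-k}_h}$ denotes the dual norm, $\|u\|_{H^{-k}_h}=\sup\{|\langle u,\varphi\rangle| : \varphi\in\mathcal S(\mathbb R^3),\ \|\varphi\|_{H^k_h}\le 1\}$. Norms of vector fields are the square roots of the sums of the squared norms of the components. $C^\infty_h(\mathbb R^{1+3})$ is the set of families $\{w^h:0<h<1\}\subset C^\infty(\mathbb R^{1+3})$ (scalar- or matrix-valued) such that for every $k\in\mathbb N$ $$\sup_{0<h<1}\ \sum_{|\alpha|\le k}\big\|(h\,\partial_{t,x})^\alpha w^h\big\|_{L^\infty(\mathbb R^{1+3})}<\infty .$$ **Theorem.** Let $\epsilon^h(t,x)$, $\mu^h(t,x)$ be families in $C^\infty_h(\mathbb R^{1+3})$ with values in the real symmetric $3\times3$ matrices, uniformly positive definite: there is $c>0$ such that $\epsilon^h(t,x)\ge cI$ and $\mu^h(t,x)\ge cI$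 for all $(t,x)\in\mathbb R^{1+3}$ and $0<h<1$. Then for every $m\in\mathbb N=\{0,1,2,\dots\}$ there is a constant $C(m)$ such that for all $E,B\in H^m(\mathbb R^3;\mathbb C^3)$, all $t\in\mathbb R$ and all $h\in(0,1)$, $$\|E\|_{H^m_h}\le C(m)\Big(\|h\,\mathrm{curl}\,E\|_{H^{m-1}_h}+\|h\,\mathrm{div}(\epsilon^h(t,\cdot)E)\|_{H^{m-1}_h}+\|E\|_{H^{m-1}_h}\Big),$$ $$\|B\|_{H^m_h}\le C(m)\Big(\|h\,\mathrm{curl}\,B\|_{H^{m-1}_h}+\|h\,\mathrm{div}(\mu^h(t,\cdot)B)\|_{H^{m-1}_h}+\|B\|_{H^{m-1}_h}\Big).$$ -/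

import Mathlib

open MeasureTheory Matrix
open scoped ENNReal NNReal SchwartzMap LineDeriv

noncomputable section

namespace Semiclassical

/-- The space `ℝ³`. -/
abbrev R3 : Type := EuclideanSpace ℝ (Fin 3)

/-- The standard basis vectors of `ℝ³`. -/
def e (i : Fin 3) : R3 := EuclideanSpace.single i 1

/-- The multi-indices `α ∈ ℕⁿ` with `|α| = α₁ + ⋯ + αₙ ≤ k`. -/
def multiIndices (n k : ℕ) : Finset (Fin n → ℕ) :=
  (Fintype.piFinset fun _ => Finset.range (k + 1)).filter fun α => ∑ i, α i ≤ k

/-! ### Coefficient families -/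

/-- The operator `h ∂_v` (`v` a direction in space-time `ℝ × ℝ³`) on real functions. -/
def hD (h : ℝ) (v : ℝ × R3) (w : ℝ × R3 → ℝ) : ℝ × R3 → ℝ :=
  fun p => h * fderiv ℝ w p v

/-- `(h ∂_{t,x})^α w` for `α ∈ ℕ⁴`; the index `0` is the time variable. -/
def hDα (h : ℝ) (α : Fin 4 → ℕ) (w : ℝ × R3 → ℝ) : ℝ × R3 → ℝ :=
  (hD h (1, 0))^[α 0]
    ((hD h (0, e 0))^[α 1] ((hD h (0, e 1))^[α 2] ((hD h (0, e 2))^[α 3] w)))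

/-- The norm `sup_{0<h<1} ∑_{|α| ≤ k} ‖(h ∂_{t,x})^α w^h‖_{L^∞(ℝ^{1+3})}` of a family `w^h`. -/
def CkNorm (k : ℕ) (w : ℝ → ℝ × R3 → ℝ) : ℝ≥0∞ :=
  ⨆ h ∈ Set.Ioo (0 : ℝ) 1, ∑ α ∈ multiIndices 4 k, eLpNorm (hDα h α (w h)) ⊤ volume

/-- Membership of a scalar family `{w^h : 0 < h < 1}` in `C^k_h(ℝ^{1+3})`. -/
def MemCk (k : ℕ) (w : ℝ → ℝ × R3 → ℝ) : Prop :=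
  (∀ h ∈ Set.Ioo (0 : ℝ) 1, ContDiff ℝ k (w h)) ∧ CkNorm k w < ⊤

/-- `C^∞_h = ⋂_k C^k_h`, for families of real `3 × 3` matrices: all entries belong to `C^k_h`
for all `k`. -/
def MemCInf (A : ℝ → ℝ × R3 → Matrix (Fin 3) (Fin 3) ℝ) : Prop :=
  ∀ (k : ℕ) (i j : Fin 3), MemCk k fun h p => A h p i j

/-- The family `A^h(t,x)`, `0 < h < 1`, consists of real symmetric matrices with
`A^h(t,x) ≥ c I` for one `c > 0`. -/
def UniformlyPosDef (A : ℝ → ℝ × R3 → Matrix (Fin 3) (Fin 3) ℝ) : Prop :=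
  ∃ c : ℝ, 0 < c ∧ ∀ h ∈ Set.Ioo (0 : ℝ) 1, ∀ p : ℝ × R3,
    (A h p).IsSymm ∧ ∀ v : Fin 3 → ℝ, c * (v ⬝ᵥ v) ≤ v ⬝ᵥ (A h p *ᵥ v)

/-! ### Semiclassical Sobolev norms of tempered distributions on `ℝ³` -/

/-- The `L²` norm of a tempered distribution: `‖f‖_{L²}` if it is given by `f ∈ L²`, and `∞` if it
is not given by an `L²` function. -/
def l2Norm (T : 𝓢'(R3, ℂ)) : ℝ≥0∞ :=
  ⨅ (f : Lp ℂ 2 (volume : Measure R3)) (_ : (f : 𝓢'(R3, ℂ)) = T), ‖f‖ₑ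

/-- The operator `h ∂_{x_i}` on distributions. -/
def hDx (h : ℝ) (i : Fin 3) (T : 𝓢'(R3, ℂ)) : 𝓢'(R3, ℂ) :=
  (h : ℂ) • ∂_{e i} T

/-- `(h ∂_x)^α T` for `α ∈ ℕ³`. -/
def hDxα (h : ℝ) (α : Fin 3 → ℕ) (T : 𝓢'(R3, ℂ)) : 𝓢'(R3, ℂ) :=
  (hDx h 0)^[α 0] ((hDx h 1)^[α 1] ((hDx h 2)^[α 2] T))

/-- The norm of `H^k_h(ℝ³)` for `k ≥ 0`, namely `(∑_{|α| ≤ k} ∫ |(h ∂_x)^α T|² dx)^{1/2}`. -/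
def sobolevNormNat (h : ℝ) (k : ℕ) (T : 𝓢'(R3, ℂ)) : ℝ≥0∞ :=
  (∑ α ∈ multiIndices 3 k, l2Norm (hDxα h α T) ^ 2) ^ (1 / 2 : ℝ)

/-- The norm of `H^s_h(ℝ³)` for an integer `s`. For `s < 0` it is the norm dual to that of
`H^{-s}_h(ℝ³)`: the supremum of `|⟨T, φ⟩|` over Schwartz functions with
`‖φ‖_{H^{-s}_h} ≤ 1`. -/
def sobolevNorm (h : ℝ) : ℤ → 𝓢'(R3, ℂ) → ℝ≥0∞
  | Int.ofNat k, T => sobolevNormNat h k T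
  | Int.negSucc k, T =>
      ⨆ (φ : 𝓢(R3, ℂ)) (_ : sobolevNormNat h (k + 1) (φ : 𝓢'(R3, ℂ)) ≤ 1), ‖T φ‖ₑ

/-- Fields on `ℝ³` with values in `ℂ³`, given by their components. -/
abbrev Field3 : Type := Fin 3 → 𝓢'(R3, ℂ)

/-- The norm of `H^s_h(ℝ³; ℂ³)`. -/
def sobolevNormVec (h : ℝ) (s : ℤ) (E : Field3) : ℝ≥0∞ :=
  (∑ j, sobolevNorm h s (E j) ^ 2) ^ (1 / 2 : ℝ)

/-- `E ∈ H^m(ℝ³; ℂ³)`. -/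
def MemHm (m : ℕ) (E : Field3) : Prop :=
  ∀ j, TemperedDistribution.MemSobolev (m : ℝ) 2 (E j)

/-! ### Vector calculus -/

/-- The curl of a field. -/
def curl (E : Field3) : Field3 :=
  ![∂_{e 1} (E 2) - ∂_{e 2} (E 1), ∂_{e 2} (E 0) - ∂_{e 0} (E 2), ∂_{e 0} (E 1) - ∂_{e 1} (E 0)]

/-- The divergence of a field. -/
def divergence (E : Field3) : 𝓢'(R3, ℂ) := ∑ j, ∂_{e j} (E j)

/-- The product `A E` of a field with a smooth real matrix function, all of whose derivatives
have at most polynomial growth. -/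
def mulField (A : R3 → Matrix (Fin 3) (Fin 3) ℝ) (E : Field3) : Field3 :=
  fun i => ∑ j, TemperedDistribution.smulLeftCLM ℂ (fun x => (A x i j : ℂ)) (E j)

end Semiclassical

end

open Semiclassical

/-!
The heart of the matter is the case `m = 0`, where the coefficients need only be bounded and
coercive. Let `d_i = h ∂_i`, `R = (1 - h²Δ)⁻¹`, and `F = conj E`. From `F = R F - h²Δ R F` and
`-Δ = curl curl - grad div` one gets the splitting

`F_i = R F_i - ∑_k d_k R (d_k F_i - d_i F_k) - d_i (∑_k d_k R F_k)`

(`helmholtz_decomposition`). In `c ‖E‖² ≤ Re ⟨A E, F⟩` the first two terms of `F` are bounded in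
`L²` by the norms of `E` and `h curl E` in `H^{-1}_h`, because `R` maps `H^{-1}_h` to `H^1_h` with a
constant independent of `h` (`normH1_resolvent_le`). The last term, after an integration by parts,
contributes `⟨h div (A E), ∑_k d_k R F_k⟩`, where `‖d_k R F_k‖_{H^1_h} ≤ 4 ‖E_k‖_{L²}`
(`normH1_hDS_resolvent_le`). Division by `‖E‖` proves the estimate for Schwartz fields
(`sum_normL2_le`), and `L²` fields are reached by density (`sum_norm_le`).

The passage from `m` to `m + 1` applies the estimate to the fields `d_i E`. The curl commutes with
`d_i`, and the commutator of `h div (A ·)` with `d_i` is `h div ((d_i A) ·)`, whose norm of order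
`m - 1` is at most a constant times `‖E‖_{H^m_h}`, because multiplication by a function with bounded
`h`-derivatives is bounded on `H^m_h` (`recNorm_smulLeftCLM_le`). The term `‖E‖_{H^m_h}` is part of
the right-hand side at order `m + 1` (`ellipticRHS_hDx_le`). All constants depend on `A` only
through `c` and the bounds of the `h`-derivatives of `A`, so that they are uniform in `t` and `h`.
-/

open LineDeriv

namespace Semiclassical

/-! ### The `L²` norm of a tempered distribution -/

theorem toTemperedDistribution_injective :
    Function.Injective
      (Lp.toTemperedDistribution : Lp ℂ 2 (volume : Measure R3) → 𝓢'(R3, ℂ)) :=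
  LinearMap.ker_eq_bot.1 (Lp.ker_toTemperedDistributionCLM_eq_bot (F := ℂ) (p := 2)
    (μ := (volume : Measure R3)))

theorem l2Norm_coe (f : Lp ℂ 2 (volume : Measure R3)) : l2Norm (f : 𝓢'(R3, ℂ)) = ‖f‖ₑ := by
  refine le_antisymm (iInf₂_le_of_le f rfl le_rfl) (le_iInf₂ fun g hg => ?_)
  rw [toTemperedDistribution_injective hg]

theorem exists_coe_eq_of_l2Norm_ne_top {T : 𝓢'(R3, ℂ)} (hT : l2Norm T ≠ ⊤) :
    ∃ f : Lp ℂ 2 (volume : Measure R3), (f : 𝓢'(R3, ℂ)) = T := by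
  by_contra! hc
  exact hT (by simp [l2Norm, hc])

theorem l2Norm_add_le (S T : 𝓢'(R3, ℂ)) : l2Norm (S + T) ≤ l2Norm S + l2Norm T := by
  by_cases hS : l2Norm S = ⊤
  · simp [hS]
  by_cases hT : l2Norm T = ⊤
  · simp [hT]
  obtain ⟨f, rfl⟩ := exists_coe_eq_of_l2Norm_ne_top hS
  obtain ⟨g, rfl⟩ := exists_coe_eq_of_l2Norm_ne_top hT
  have : (f : 𝓢'(R3, ℂ)) + (g : 𝓢'(R3, ℂ)) = ((f + g : Lp ℂ 2 (volume : Measure R3)) : 𝓢'(R3, ℂ)) :=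
    (map_add (Lp.toTemperedDistributionCLM ℂ (volume : Measure R3) 2) f g).symm
  rw [this, l2Norm_coe, l2Norm_coe, l2Norm_coe]
  exact enorm_add_le f g

theorem l2Norm_neg_le (T : 𝓢'(R3, ℂ)) : l2Norm (-T) ≤ l2Norm T := by
  by_cases hT : l2Norm T = ⊤
  · simp [hT]
  obtain ⟨f, rfl⟩ := exists_coe_eq_of_l2Norm_ne_top hT
  have : -(f : 𝓢'(R3, ℂ)) = ((-f : Lp ℂ 2 (volume : Measure R3)) : 𝓢'(R3, ℂ)) :=
    (map_neg (Lp.toTemperedDistributionCLM ℂ (volume : Measure R3) 2) f).symm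
  rw [this, l2Norm_coe, l2Norm_coe, enorm_neg]

/-- The hypothesis `0 < M` is needed for `l2Norm T = ∞`, where `0 * ∞ = 0`. -/
theorem l2Norm_smulLeftCLM_le {a : R3 → ℂ} (ha : a.HasTemperateGrowth) {M : ℝ≥0} (hM : 0 < M)
    (hb : ∀ x, ‖a x‖ ≤ M) (T : 𝓢'(R3, ℂ)) :
    l2Norm (TemperedDistribution.smulLeftCLM ℂ a T) ≤ M * l2Norm T := by
  by_cases hT : l2Norm T = ⊤
  · simp [hT, hM.ne']
  obtain ⟨f, rfl⟩ := exists_coe_eq_of_l2Norm_ne_top hT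
  have hmem : MemLp a ⊤ (volume : Measure R3) :=
    memLp_top_of_bound ha.1.continuous.aestronglyMeasurable M (ae_of_all _ hb)
  rw [← Lp.toTemperedDistribution_smul_eq (r := 2) ha hmem f, l2Norm_coe, l2Norm_coe]
  rw [Lp.enorm_def, Lp.enorm_def]
  refine (eLpNorm_le_mul_eLpNorm_of_ae_le_mul (c := (M : ℝ)) (g := f) ?_ 2).trans (by simp)
  filter_upwards [Lp.coeFn_lpSMul (r := 2) (hmem.toLp _) f, hmem.coeFn_toLp] with x hx hx'
  rw [hx, Pi.smul_apply', hx', norm_smul]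
  gcongr
  exact hb x

/-- The Cauchy-Schwarz inequality for the action of an `L²` function on a Schwartz function. -/
theorem enorm_apply_le (f : Lp ℂ 2 (volume : Measure R3)) (φ : 𝓢(R3, ℂ)) :
    ‖(f : 𝓢'(R3, ℂ)) φ‖ₑ ≤ ‖f‖ₑ * ‖φ.toLp 2 volume‖ₑ := by
  rw [Lp.toTemperedDistribution_apply, SchwartzMap.toLp, Lp.enorm_toLp, Lp.enorm_def, mul_comm]
  refine (enorm_integral_le_lintegral_enorm _).trans ?_
  rw [← eLpNorm_one_eq_lintegral_enorm]
  have key := eLpNorm_smul_le_mul_eLpNorm (p := 2) (q := 2) (r := 1) (μ := volume)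
    (φ := (φ : R3 → ℂ)) (f := (f : R3 → ℂ)) (Lp.aestronglyMeasurable f)
    φ.continuous.aestronglyMeasurable
  exact key

/-! ### The operators `h ∂_i` on distributions -/

/-- The operator `h ∂_i` on Schwartz functions. -/
noncomputable def hDS (h : ℝ) (i : Fin 3) : 𝓢(R3, ℂ) →L[ℂ] 𝓢(R3, ℂ) :=
  (h : ℂ) • lineDerivOpCLM ℂ 𝓢(R3, ℂ) (e i)

theorem hDS_eq (h : ℝ) (i : Fin 3) (φ : 𝓢(R3, ℂ)) : hDS h i φ = (h : ℂ) • ∂_{e i} φ := rfl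

theorem hDS_eq_fourierMultiplierCLM (h : ℝ) (i : Fin 3) (φ : 𝓢(R3, ℂ)) :
    hDS h i φ = ((h : ℂ) * (2 * (Real.pi : ℂ) * Complex.I)) •
      SchwartzMap.fourierMultiplierCLM ℂ (fun x : R3 => ((inner ℝ x (e i) : ℝ) : ℂ)) φ := by
  rw [hDS_eq, SchwartzMap.lineDeriv_eq_fourierMultiplierCLM, smul_smul]
  congr 1
  exact (SchwartzMap.fourierMultiplierCLM_ofReal ℂ (by fun_prop) φ).symm

theorem hDS_comm (h : ℝ) (i j : Fin 3) (φ : 𝓢(R3, ℂ)) :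
    hDS h i (hDS h j φ) = hDS h j (hDS h i φ) := by
  simp only [hDS_eq_fourierMultiplierCLM, map_smul]
  rw [SchwartzMap.fourierMultiplierCLM_fourierMultiplierCLM_apply (by fun_prop) (by fun_prop),
    SchwartzMap.fourierMultiplierCLM_fourierMultiplierCLM_apply (by fun_prop) (by fun_prop),
    mul_comm (fun x : R3 => ((inner ℝ x (e i) : ℝ) : ℂ))]

theorem hDx_apply (h : ℝ) (i : Fin 3) (T : 𝓢'(R3, ℂ)) (φ : 𝓢(R3, ℂ)) :
    hDx h i T φ = -T (hDS h i φ) := by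
  rw [hDS_eq, map_smul, ← smul_neg, ← map_neg]
  rfl

theorem hDx_comm (h : ℝ) (i j : Fin 3) (T : 𝓢'(R3, ℂ)) :
    hDx h i (hDx h j T) = hDx h j (hDx h i T) := by
  ext φ
  simp only [hDx_apply]
  rw [hDS_comm]

theorem hDx_add (h : ℝ) (i : Fin 3) (S T : 𝓢'(R3, ℂ)) :
    hDx h i (S + T) = hDx h i S + hDx h i T := by
  simp only [hDx, lineDerivOp_add, smul_add]

theorem hDx_neg (h : ℝ) (i : Fin 3) (T : 𝓢'(R3, ℂ)) : hDx h i (-T) = -hDx h i T := by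
  simp only [hDx, lineDerivOp_neg, smul_neg]

theorem hDx_sub (h : ℝ) (i : Fin 3) (S T : 𝓢'(R3, ℂ)) :
    hDx h i (S - T) = hDx h i S - hDx h i T := by
  rw [sub_eq_add_neg, hDx_add, hDx_neg, sub_eq_add_neg]

theorem hDx_sum {ι : Type*} (h : ℝ) (i : Fin 3) (s : Finset ι) (T : ι → 𝓢'(R3, ℂ)) :
    hDx h i (∑ j ∈ s, T j) = ∑ j ∈ s, hDx h i (T j) := by
  simp only [hDx, lineDerivOp_sum, Finset.smul_sum]

/-- The Leibniz rule for the product of a smooth function and a distribution. -/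
theorem hDx_smulLeftCLM (h : ℝ) (i : Fin 3) {a : R3 → ℝ} (ha : a.HasTemperateGrowth)
    (ha' : (fun x => h * fderiv ℝ a x (e i)).HasTemperateGrowth) (T : 𝓢'(R3, ℂ)) :
    hDx h i (TemperedDistribution.smulLeftCLM ℂ (fun x => (a x : ℂ)) T) =
      TemperedDistribution.smulLeftCLM ℂ (fun x => ((h * fderiv ℝ a x (e i) : ℝ) : ℂ)) T +
        TemperedDistribution.smulLeftCLM ℂ (fun x => (a x : ℂ)) (hDx h i T) := by
  have hc : (fun x => (a x : ℂ)).HasTemperateGrowth :=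
    Function.Complex.hasTemperateGrowth_ofReal.comp ha
  have hc' : (fun x => ((h * fderiv ℝ a x (e i) : ℝ) : ℂ)).HasTemperateGrowth :=
    Function.Complex.hasTemperateGrowth_ofReal.comp ha'
  ext φ
  rw [hDx_apply, _root_.add_apply, TemperedDistribution.smulLeftCLM_apply_apply,
    TemperedDistribution.smulLeftCLM_apply_apply, TemperedDistribution.smulLeftCLM_apply_apply,
    hDx_apply, ← sub_eq_add_neg, ← map_neg, ← map_sub]
  congr 1
  ext x
  have h1 : HasFDerivAt (fun x => (a x : ℂ)) (Complex.ofRealCLM ∘L fderiv ℝ a x) x :=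
    Complex.ofRealCLM.hasFDerivAt.comp x
      ((ha.1.differentiable (by simp)) x).hasFDerivAt
  have h2 := h1.mul (φ.hasFDerivAt x)
  have h3 : ∂_{e i} (SchwartzMap.smulLeftCLM ℂ (fun x => (a x : ℂ)) φ) x =
      (a x : ℂ) * ∂_{e i} φ x + (fderiv ℝ a x (e i) : ℝ) * φ x := by
    rw [SchwartzMap.lineDerivOp_apply_eq_fderiv, SchwartzMap.lineDerivOp_apply_eq_fderiv,
      SchwartzMap.smulLeftCLM_apply hc]
    change fderiv ℝ ((fun x => (a x : ℂ)) * (φ : R3 → ℂ)) x (e i) = _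
    rw [h2.fderiv]
    simp [mul_comm]
  simp only [hDS_eq, _root_.neg_apply, _root_.sub_apply, _root_.smul_apply, h3,
    SchwartzMap.smulLeftCLM_apply_apply hc, SchwartzMap.smulLeftCLM_apply_apply hc', smul_eq_mul]
  push_cast
  ring

/-! ### Recursive form of the Sobolev norms -/

/-- The norm of `H^k_h(ℝ³)` in recursive form: `‖T‖_{L²}` for `k = 0`, and
`‖T‖_{L²} + ∑_i ‖h ∂_i T‖_{H^k_h}` at order `k + 1`. It is equivalent to `sobolevNormNat`, with
constants depending on `k` only. -/
noncomputable def recNorm (h : ℝ) : ℕ → 𝓢'(R3, ℂ) → ℝ≥0∞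
  | 0, T => l2Norm T
  | k + 1, T => l2Norm T + ∑ i, recNorm h k (hDx h i T)

theorem l2Norm_le_recNorm (h : ℝ) (k : ℕ) (T : 𝓢'(R3, ℂ)) : l2Norm T ≤ recNorm h k T := by
  cases k with
  | zero => exact le_rfl
  | succ k => exact le_self_add

theorem recNorm_hDx_le (h : ℝ) (k : ℕ) (i : Fin 3) (T : 𝓢'(R3, ℂ)) :
    recNorm h k (hDx h i T) ≤ recNorm h (k + 1) T :=
  (Finset.single_le_sum (f := fun i => recNorm h k (hDx h i T)) (fun _ _ => zero_le)
    (Finset.mem_univ i)).trans le_add_self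

theorem recNorm_add_le (h : ℝ) (k : ℕ) (S T : 𝓢'(R3, ℂ)) :
    recNorm h k (S + T) ≤ recNorm h k S + recNorm h k T := by
  induction k generalizing S T with
  | zero => exact l2Norm_add_le S T
  | succ k ih =>
    simp only [recNorm, hDx_add]
    refine (add_le_add (l2Norm_add_le S T)
      (Finset.sum_le_sum fun i _ => ih (hDx h i S) (hDx h i T))).trans_eq ?_
    rw [Finset.sum_add_distrib]
    ring

theorem recNorm_neg_le (h : ℝ) (k : ℕ) (T : 𝓢'(R3, ℂ)) : recNorm h k (-T) ≤ recNorm h k T := by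
  induction k generalizing T with
  | zero => exact l2Norm_neg_le T
  | succ k ih =>
    simp only [recNorm, hDx_neg]
    exact add_le_add (l2Norm_neg_le T) (Finset.sum_le_sum fun i _ => ih (hDx h i T))

theorem recNorm_le_succ (h : ℝ) (k : ℕ) (T : 𝓢'(R3, ℂ)) :
    recNorm h k T ≤ recNorm h (k + 1) T := by
  induction k generalizing T with
  | zero => exact le_self_add
  | succ k ih => exact add_le_add le_rfl (Finset.sum_le_sum fun i _ => ih (hDx h i T))

theorem mem_multiIndices {n k : ℕ} {α : Fin n → ℕ} : α ∈ multiIndices n k ↔ ∑ i, α i ≤ k := by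
  simp only [multiIndices, Finset.mem_filter, Fintype.mem_piFinset, Finset.mem_range,
    and_iff_right_iff_imp]
  exact fun hα i => Nat.lt_succ_of_le
    ((Finset.single_le_sum (f := α) (fun _ _ => Nat.zero_le _) (Finset.mem_univ i)).trans hα)

theorem hDxα_add_single (h : ℝ) (α : Fin 3 → ℕ) (i : Fin 3) (T : 𝓢'(R3, ℂ)) :
    hDxα h (α + Pi.single i 1) T = hDx h i (hDxα h α T) := by
  have hc : ∀ j (n : ℕ) S, (hDx h j)^[n] (hDx h i S) = hDx h i ((hDx h j)^[n] S) :=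
    fun j n S => ((show Function.Commute (hDx h j) (hDx h i) from
      fun T => hDx_comm h j i T).iterate_left n S)
  fin_cases i <;>
    simp only [Fin.zero_eta, Fin.mk_one, Fin.reduceFinMk] at hc ⊢ <;>
    simp [hDxα, Function.iterate_succ_apply', hc]

theorem hDxα_hDx (h : ℝ) (α : Fin 3 → ℕ) (i : Fin 3) (T : 𝓢'(R3, ℂ)) :
    hDxα h α (hDx h i T) = hDxα h (α + Pi.single i 1) T := by
  have hc : ∀ j (n : ℕ) S, (hDx h j)^[n] (hDx h i S) = hDx h i ((hDx h j)^[n] S) :=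
    fun j n S => ((show Function.Commute (hDx h j) (hDx h i) from
      fun T => hDx_comm h j i T).iterate_left n S)
  rw [hDxα_add_single]
  simp only [hDxα, hc]

theorem l2Norm_hDxα_le_recNorm (h : ℝ) {k : ℕ} {α : Fin 3 → ℕ} (hα : ∑ i, α i ≤ k)
    (T : 𝓢'(R3, ℂ)) : l2Norm (hDxα h α T) ≤ recNorm h k T := by
  induction k generalizing α T with
  | zero =>
    have : α = 0 := by
      ext i
      simpa using (Finset.sum_eq_zero_iff.1 (Nat.le_zero.1 hα)) i (Finset.mem_univ i)
    subst this
    exact le_rfl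
  | succ k ih =>
    by_cases h0 : α = 0
    · subst h0
      exact l2Norm_le_recNorm h (k + 1) T
    · obtain ⟨i, hi⟩ := Function.ne_iff.1 h0
      have hi' : α = (α - Pi.single i 1) + Pi.single i 1 := by
        refine (tsub_add_cancel_of_le ?_).symm
        intro j
        by_cases hj : j = i
        · subst hj
          simpa using Nat.one_le_iff_ne_zero.2 hi
        · simp [hj]
      rw [hi', ← hDxα_hDx]
      refine (ih ?_ _).trans (recNorm_hDx_le h k i T)
      rw [hi'] at hα
      simp only [Pi.add_apply, Finset.sum_add_distrib, Finset.sum_pi_single', Finset.mem_univ,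
        if_true] at hα
      omega

theorem le_rpow_sum_sq {ι : Type*} (s : Finset ι) (f : ι → ℝ≥0∞) {i : ι} (hi : i ∈ s) :
    f i ≤ (∑ j ∈ s, f j ^ 2) ^ (1 / 2 : ℝ) := by
  have h1 : f i ^ 2 ≤ ∑ j ∈ s, f j ^ 2 :=
    Finset.single_le_sum (f := fun j => f j ^ 2) (fun _ _ => zero_le) hi
  calc f i = (f i ^ 2) ^ (1 / 2 : ℝ) := by
        rw [← ENNReal.rpow_two, ← ENNReal.rpow_mul]
        norm_num
    _ ≤ _ := ENNReal.rpow_le_rpow h1 (by norm_num)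

theorem rpow_sum_sq_le_sum {ι : Type*} (s : Finset ι) (f : ι → ℝ≥0∞) :
    (∑ j ∈ s, f j ^ 2) ^ (1 / 2 : ℝ) ≤ ∑ j ∈ s, f j := by
  have h1 : ∑ j ∈ s, f j ^ 2 ≤ (∑ j ∈ s, f j) ^ 2 := by
    rw [sq (∑ j ∈ s, f j), Finset.sum_mul]
    refine Finset.sum_le_sum fun j hj => ?_
    rw [sq]
    gcongr
    exact Finset.single_le_sum (f := f) (fun _ _ => zero_le) hj
  calc _ ≤ ((∑ j ∈ s, f j) ^ 2) ^ (1 / 2 : ℝ) := ENNReal.rpow_le_rpow h1 (by norm_num)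
    _ = _ := by
        rw [← ENNReal.rpow_two, ← ENNReal.rpow_mul]
        norm_num

theorem sobolevNormNat_le_recNorm (h : ℝ) (k : ℕ) (T : 𝓢'(R3, ℂ)) :
    sobolevNormNat h k T ≤ ((multiIndices 3 k).card : ℝ≥0) * recNorm h k T := by
  refine (rpow_sum_sq_le_sum _ _).trans ?_
  refine (Finset.sum_le_sum fun α hα => l2Norm_hDxα_le_recNorm h (mem_multiIndices.1 hα) T).trans ?_
  simp

/-- The derivative `(h ∂)^β` is carried along so that the induction on `k`, which moves derivatives
from the norm to the multi-index, closes at a fixed total order `K`. -/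
theorem recNorm_hDxα_le_sobolevNormNat (h : ℝ) (k : ℕ) {K : ℕ} {β : Fin 3 → ℕ}
    (hK : k + ∑ i, β i ≤ K) (T : 𝓢'(R3, ℂ)) :
    recNorm h k (hDxα h β T) ≤ (4 ^ k : ℝ≥0) * sobolevNormNat h K T := by
  have h0 : ∀ {β : Fin 3 → ℕ}, ∑ i, β i ≤ K → l2Norm (hDxα h β T) ≤ sobolevNormNat h K T :=
    fun hβ => le_rpow_sum_sq (multiIndices 3 K) (fun α => l2Norm (hDxα h α T))
      (mem_multiIndices.2 hβ)
  induction k generalizing β with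
  | zero => simpa [recNorm] using h0 (by omega)
  | succ k ih =>
    rw [recNorm]
    simp only [← hDxα_add_single]
    refine (add_le_add (h0 (by omega))
      (Finset.sum_le_sum fun i _ => ih (β := β + Pi.single i 1) ?_)).trans ?_
    · simp only [Pi.add_apply, Finset.sum_add_distrib, Finset.sum_pi_single', Finset.mem_univ,
        if_true]
      omega
    · simp only [Finset.sum_const, Finset.card_univ, Fintype.card_fin, nsmul_eq_mul]
      rw [← mul_assoc]
      nth_rewrite 1 [← one_mul (sobolevNormNat h K T)]
      rw [← add_mul]
      gcongr
      norm_cast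
      have := Nat.one_le_pow k 4 (by norm_num)
      rw [pow_succ]
      omega

theorem recNorm_le_sobolevNormNat (h : ℝ) (k : ℕ) (T : 𝓢'(R3, ℂ)) :
    recNorm h k T ≤ (4 ^ k : ℝ≥0) * sobolevNormNat h k T :=
  recNorm_hDxα_le_sobolevNormNat h k (β := 0) (by simp) T

/-! ### Norms of order `m - 1` -/

/-- A norm of order `m - 1` equivalent to that of `H^{m-1}_h(ℝ³)`: the dual norm for `m = 0`, and
the recursive norm for `m ≥ 1`. -/
noncomputable def predNorm (h : ℝ) : ℕ → 𝓢'(R3, ℂ) → ℝ≥0∞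
  | 0, T => sobolevNorm h (-1) T
  | m + 1, T => recNorm h m T

theorem predNorm_add_le (h : ℝ) (m : ℕ) (S T : 𝓢'(R3, ℂ)) :
    predNorm h m (S + T) ≤ predNorm h m S + predNorm h m T := by
  cases m with
  | zero =>
    refine iSup₂_le fun φ hφ => ?_
    rw [_root_.add_apply]
    exact (enorm_add_le _ _).trans (add_le_add (le_iSup₂ (f := fun φ _ => ‖S φ‖ₑ) φ hφ)
      (le_iSup₂ (f := fun φ _ => ‖T φ‖ₑ) φ hφ))
  | succ m => exact recNorm_add_le h m S T

theorem predNorm_neg_le (h : ℝ) (m : ℕ) (T : 𝓢'(R3, ℂ)) : predNorm h m (-T) ≤ predNorm h m T := by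
  cases m with
  | zero =>
    refine iSup₂_le fun φ hφ => ?_
    rw [_root_.neg_apply, enorm_neg]
    exact le_iSup₂ (f := fun φ _ => ‖T φ‖ₑ) φ hφ
  | succ m => exact recNorm_neg_le h m T

theorem predNorm_zero (h : ℝ) (m : ℕ) : predNorm h m 0 = 0 := by
  cases m with
  | zero =>
    refine le_antisymm (iSup₂_le fun φ hφ => ?_) zero_le
    simp
  | succ m =>
    have hz : ∀ i, hDx h i (0 : 𝓢'(R3, ℂ)) = 0 := fun i => by
      simpa using hDx_sub h i (0 : 𝓢'(R3, ℂ)) 0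
    have h0 : l2Norm (0 : 𝓢'(R3, ℂ)) = 0 := by
      have := l2Norm_coe 0
      rwa [show ((0 : Lp ℂ 2 (volume : Measure R3)) : 𝓢'(R3, ℂ)) = 0 from
        map_zero (Lp.toTemperedDistributionCLM ℂ (volume : Measure R3) 2), enorm_zero] at this
    rw [predNorm]
    induction m with
    | zero => exact h0
    | succ m ih => simp [recNorm, hz, h0, ih]

theorem predNorm_sub_le (h : ℝ) (m : ℕ) (S T : 𝓢'(R3, ℂ)) :
    predNorm h m (S - T) ≤ predNorm h m S + predNorm h m T := by
  rw [sub_eq_add_neg]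
  exact (predNorm_add_le h m S (-T)).trans (by gcongr; exact predNorm_neg_le h m T)

theorem predNorm_sum_le (h : ℝ) (m : ℕ) {ι : Type*} (s : Finset ι) (T : ι → 𝓢'(R3, ℂ)) :
    predNorm h m (∑ j ∈ s, T j) ≤ ∑ j ∈ s, predNorm h m (T j) :=
  Finset.le_sum_of_subadditive _ (predNorm_zero h m).le (predNorm_add_le h m) s T

theorem l2Norm_toTemperedDistribution (φ : 𝓢(R3, ℂ)) :
    l2Norm (φ : 𝓢'(R3, ℂ)) = ‖φ.toLp 2 volume‖ₑ := by
  rw [← l2Norm_coe, Lp.toTemperedDistribution_toLp_eq]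

theorem hDx_toTemperedDistribution (h : ℝ) (i : Fin 3) (φ : 𝓢(R3, ℂ)) :
    hDx h i (φ : 𝓢'(R3, ℂ)) = (hDS h i φ : 𝓢(R3, ℂ)) := by
  rw [hDx, TemperedDistribution.lineDerivOp_toTemperedDistributionCLM_eq, hDS_eq, map_smul]

theorem enorm_toLp_hDS_le (h : ℝ) (i : Fin 3) (φ : 𝓢(R3, ℂ)) :
    ‖(hDS h i φ).toLp 2 volume‖ₑ ≤ sobolevNormNat h 1 (φ : 𝓢'(R3, ℂ)) := by
  rw [← l2Norm_toTemperedDistribution, ← hDx_toTemperedDistribution]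
  have h1 := le_rpow_sum_sq (multiIndices 3 1) (fun α => l2Norm (hDxα h α (φ : 𝓢'(R3, ℂ))))
    (i := 0 + Pi.single i 1) (mem_multiIndices.2 (by simp))
  simp only [hDxα_add_single] at h1
  exact h1

/-- The operators `h ∂_i` have order one, also from `L²` to `H^{-1}_h`, by duality. -/
theorem predNorm_hDx_le (h : ℝ) (m : ℕ) (i : Fin 3) (T : 𝓢'(R3, ℂ)) :
    predNorm h m (hDx h i T) ≤ recNorm h m T := by
  cases m with
  | zero =>
    rw [recNorm]
    by_cases hT : l2Norm T = ⊤
    · simp [hT]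
    obtain ⟨f, rfl⟩ := exists_coe_eq_of_l2Norm_ne_top hT
    refine iSup₂_le fun φ hφ => ?_
    rw [hDx_apply, enorm_neg, l2Norm_coe]
    refine (enorm_apply_le f _).trans ?_
    calc _ ≤ ‖f‖ₑ * 1 := by
          gcongr
          exact (enorm_toLp_hDS_le h i φ).trans hφ
      _ = _ := mul_one _
  | succ m => exact recNorm_hDx_le h m i T

theorem exists_predNorm_le_sobolevNorm (m : ℕ) :
    ∃ C : ℝ≥0, ∀ h T, predNorm h m T ≤ C * sobolevNorm h ((m : ℤ) - 1) T := by
  cases m with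
  | zero => exact ⟨1, fun h T => by simp [predNorm]⟩
  | succ m =>
    refine ⟨4 ^ m, fun h T => ?_⟩
    rw [show ((m + 1 : ℕ) : ℤ) - 1 = Int.ofNat m by simp]
    exact_mod_cast recNorm_le_sobolevNormNat h m T

/-! ### Membership in `H^m` -/

theorem recNorm_ne_top_of_memSobolev (h : ℝ) (m : ℕ) {T : 𝓢'(R3, ℂ)}
    (hT : TemperedDistribution.MemSobolev (m : ℝ) 2 T) : recNorm h m T ≠ ⊤ := by
  have h0 : ∀ {T : 𝓢'(R3, ℂ)}, TemperedDistribution.MemSobolev 0 2 T → l2Norm T ≠ ⊤ := by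
    intro T hT
    obtain ⟨f, rfl⟩ := TemperedDistribution.memSobolev_zero_iff.1 hT
    rw [l2Norm_coe]
    exact enorm_ne_top
  induction m generalizing T with
  | zero => exact h0 (by simpa using hT)
  | succ m ih =>
    rw [recNorm]
    refine ENNReal.add_ne_top.2
      ⟨h0 (hT.mono (by positivity)), ENNReal.sum_ne_top.2 fun i _ => ih ?_⟩
    refine TemperedDistribution.MemSobolev.smul _ ?_
    have := hT.lineDerivOp (m := e i)
    simpa using this

/-! ### Coefficients with bounded `h`-derivatives -/

/-- `a` and its derivatives `(h ∂)^α a`, `|α| ≤ k`, are bounded by `M`, in recursive form. -/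
def CoeffBound (h : ℝ) (M : ℝ≥0) : ℕ → (R3 → ℝ) → Prop
  | 0, a => ∀ x, |a x| ≤ M
  | k + 1, a => (∀ x, |a x| ≤ M) ∧ ∀ i, CoeffBound h M k fun x => h * fderiv ℝ a x (e i)

theorem CoeffBound.abs_le {h : ℝ} {M : ℝ≥0} {k : ℕ} {a : R3 → ℝ} (ha : CoeffBound h M k a)
    (x : R3) : |a x| ≤ M := by
  cases k with
  | zero => exact ha x
  | succ k => exact ha.1 x

theorem CoeffBound.of_succ {h : ℝ} {M : ℝ≥0} {k : ℕ} {a : R3 → ℝ}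
    (ha : CoeffBound h M (k + 1) a) : CoeffBound h M k a := by
  induction k generalizing a with
  | zero => exact ha.1
  | succ k ih => exact ⟨ha.1, fun i => ih (ha.2 i)⟩

theorem hasTemperateGrowth_fderiv_apply {a : R3 → ℝ} (ha : a.HasTemperateGrowth) (h : ℝ) (v : R3) :
    (fun x => h * fderiv ℝ a x v).HasTemperateGrowth := by
  have h1 : (fderiv ℝ a).HasTemperateGrowth := by
    refine ⟨ha.1.fderiv_right (by simp), fun n => ?_⟩
    obtain ⟨k, C, hC⟩ := ha.2 (n + 1)
    exact ⟨k, C, fun x => by rw [norm_iteratedFDeriv_fderiv]; exact hC x⟩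
  have h2 := (ContinuousLinearMap.apply ℝ ℝ v).hasTemperateGrowth.comp h1
  exact (Function.HasTemperateGrowth.const h).mul h2

/-- A smooth function all of whose `h`-derivatives are bounded has temperate growth. -/
theorem hasTemperateGrowth_of_coeffBound {h : ℝ} (hh : h ≠ 0) {a : R3 → ℝ}
    (ha : ContDiff ℝ (⊤ : ℕ∞) a) (hb : ∀ k, ∃ M, CoeffBound h M k a) : a.HasTemperateGrowth := by
  refine ⟨ha, fun n => ?_⟩
  suffices ∀ (n : ℕ) (M : ℝ≥0) (a : R3 → ℝ), ContDiff ℝ (⊤ : ℕ∞) a → CoeffBound h M n a →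
      ∃ C, ∀ x, ‖iteratedFDeriv ℝ n a x‖ ≤ C by
    obtain ⟨M, hM⟩ := hb n
    obtain ⟨C, hC⟩ := this n M a ha hM
    exact ⟨0, C, by simpa using hC⟩
  clear hb ha a n
  intro n M
  induction n with
  | zero => exact fun a _ hb => ⟨M, fun x => by simpa using hb x⟩
  | succ n ih =>
    intro a ha hb
    have hda : ContDiff ℝ (⊤ : ℕ∞) (fderiv ℝ a) := ha.fderiv_right (by simp)
    have hdi : ∀ i, ContDiff ℝ (⊤ : ℕ∞) fun x => h * fderiv ℝ a x (e i) := fun i =>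
      contDiff_const.mul (hda.clm_apply contDiff_const)
    choose C hC using fun i => ih _ (hdi i) (hb.2 i)
    let L : Fin 3 → ℝ →L[ℝ] (R3 →L[ℝ] ℝ) := fun i =>
      h⁻¹ • ContinuousLinearMap.toSpanSingleton ℝ (EuclideanSpace.proj i : R3 →L[ℝ] ℝ)
    -- The differential in terms of the partial derivatives `h ∂_i a`; this is where `h ≠ 0` enters.
    have hsum : fderiv ℝ a = fun x => ∑ i, ((L i) ∘ (fun x => h * fderiv ℝ a x (e i))) x := by
      funext x
      refine ContinuousLinearMap.ext fun v => ?_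
      have hv : v = ∑ i, v i • e i := by
        ext j
        simp [e, Finset.sum_apply, Pi.single_apply]
      conv_lhs => rw [hv, map_sum]
      simp only [_root_.sum_apply, L, Function.comp]
      refine Finset.sum_congr rfl fun i _ => ?_
      simp
      field_simp
    refine ⟨∑ i, ‖L i‖ * C i, fun x => ?_⟩
    rw [← norm_iteratedFDeriv_fderiv, hsum, iteratedFDeriv_sum (fun i _ =>
      ((L i).contDiff.comp (hdi i)).of_le (by exact_mod_cast le_top)), Finset.sum_apply]
    refine (norm_sum_le _ _).trans (Finset.sum_le_sum fun i _ => ?_)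
    refine ((L i).norm_iteratedFDeriv_comp_left (hdi i).contDiffAt
      (by exact_mod_cast le_top)).trans ?_
    gcongr
    exact hC i x

/-- Multiplication by a coefficient with bounded `h`-derivatives is bounded on `H^k_h`. -/
theorem recNorm_smulLeftCLM_le {h : ℝ} {M : ℝ≥0} (hM : 0 < M) {k : ℕ} {a : R3 → ℝ}
    (ha : a.HasTemperateGrowth) (hb : CoeffBound h M k a) (T : 𝓢'(R3, ℂ)) :
    recNorm h k (TemperedDistribution.smulLeftCLM ℂ (fun x => (a x : ℂ)) T) ≤
      (7 ^ k * M : ℝ≥0) * recNorm h k T := by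
  have h0 : ∀ {k : ℕ} {a : R3 → ℝ} (T : 𝓢'(R3, ℂ)), a.HasTemperateGrowth → CoeffBound h M k a →
      l2Norm (TemperedDistribution.smulLeftCLM ℂ (fun x => (a x : ℂ)) T) ≤ M * l2Norm T :=
    fun T ha hb => l2Norm_smulLeftCLM_le (Function.Complex.hasTemperateGrowth_ofReal.comp ha) hM
      (fun x => by simpa using hb.abs_le x) T
  induction k generalizing a T with
  | zero => simpa [recNorm] using h0 T ha hb
  | succ k ih =>
    have hle : ∀ i, recNorm h k (hDx h i
        (TemperedDistribution.smulLeftCLM ℂ (fun x => (a x : ℂ)) T)) ≤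
        (7 ^ k * M : ℝ≥0) * (recNorm h k T + recNorm h k (hDx h i T)) := fun i => by
      rw [hDx_smulLeftCLM h i ha (hasTemperateGrowth_fderiv_apply ha h (e i)), mul_add]
      exact (recNorm_add_le _ _ _ _).trans (add_le_add
        (ih (hasTemperateGrowth_fderiv_apply ha h (e i)) (hb.2 i) T) (ih ha hb.of_succ _))
    have hT : recNorm h k T ≤ recNorm h (k + 1) T := recNorm_le_succ h k T
    calc recNorm h (k + 1) (TemperedDistribution.smulLeftCLM ℂ (fun x => (a x : ℂ)) T)
        ≤ (7 ^ k * M : ℝ≥0) * l2Norm T + ∑ i, (7 ^ k * M : ℝ≥0) *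
            (recNorm h k T + recNorm h k (hDx h i T)) := by
          refine add_le_add ((h0 T ha hb).trans ?_) (Finset.sum_le_sum fun i _ => hle i)
          gcongr
          exact le_mul_of_one_le_left zero_le (one_le_pow₀ (by norm_num))
      _ ≤ (7 ^ k * M : ℝ≥0) * recNorm h (k + 1) T + ∑ i : Fin 3, (7 ^ k * M : ℝ≥0) *
            (recNorm h (k + 1) T + recNorm h (k + 1) T) := by
          gcongr with i
          · exact l2Norm_le_recNorm h (k + 1) T
          · exact recNorm_hDx_le h k i T
      _ = _ := by
          simp only [Finset.sum_const, Finset.card_univ, Fintype.card_fin, nsmul_eq_mul]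
          push_cast
          ring

/-! ### Coefficient families -/

/-- For continuous functions an almost everywhere bound holds everywhere. -/
theorem abs_le_of_eLpNorm_top_le {w : ℝ × R3 → ℝ} (hw : Continuous w) {M : ℝ≥0}
    (hM : eLpNorm w ⊤ volume ≤ M) (p : ℝ × R3) : |w p| ≤ M := by
  have h1 : ∀ᵐ q ∂(volume : Measure (ℝ × R3)), |w q| ≤ M := by
    filter_upwards [enorm_ae_le_eLpNormEssSup w volume] with q hq
    rw [← eLpNorm_exponent_top] at hq
    have := hq.trans hM
    rw [enorm_le_coe] at this
    exact_mod_cast this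
  have h2 : (fun q => max |w q| M) = fun _ => (M : ℝ) := by
    refine (Continuous.ae_eq_iff_eq (volume : Measure (ℝ × R3)) (by fun_prop) (by fun_prop)).1 ?_
    filter_upwards [h1] with q hq using max_eq_right hq
  exact max_eq_right_iff.1 (congrFun h2 p)

theorem contDiff_hD (h : ℝ) (v : ℝ × R3) {w : ℝ × R3 → ℝ} (hw : ContDiff ℝ (⊤ : ℕ∞) w) :
    ContDiff ℝ (⊤ : ℕ∞) (hD h v w) :=
  contDiff_const.mul ((hw.fderiv_right (m := (⊤ : ℕ∞)) (by simp)).clm_apply contDiff_const)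

theorem hD_comm (h : ℝ) (v v' : ℝ × R3) {w : ℝ × R3 → ℝ} (hw : ContDiff ℝ (⊤ : ℕ∞) w) :
    hD h v (hD h v' w) = hD h v' (hD h v w) := by
  have hdw : Differentiable ℝ (fderiv ℝ w) :=
    (hw.fderiv_right (m := (⊤ : ℕ∞)) (by simp)).differentiable (by simp)
  have key : ∀ v v' : ℝ × R3, ∀ p, hD h v (hD h v' w) p =
      h * (h * fderiv ℝ (fderiv ℝ w) p v v') := fun v v' p => by
    have h1 : HasFDerivAt (fun p => fderiv ℝ w p v')
        ((ContinuousLinearMap.apply ℝ ℝ v') ∘L fderiv ℝ (fderiv ℝ w) p) p :=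
      (ContinuousLinearMap.apply ℝ ℝ v').hasFDerivAt.comp p (hdw p).hasFDerivAt
    have h2 := h1.const_mul h
    change h * fderiv ℝ (fun p => h * fderiv ℝ w p v') p v = _
    rw [h2.fderiv]
    simp
  funext p
  rw [key, key]
  have hs : IsSymmSndFDerivAt ℝ w p :=
    hw.contDiffAt.isSymmSndFDerivAt (by
      rw [minSmoothness_of_isRCLikeNormedField]
      exact WithTop.coe_le_coe.2 (le_top (a := (2 : ℕ∞))))
  rw [hs.eq]

/-- The operators `h ∂_v` on the smooth functions on `ℝ × ℝ³`, where they commute. -/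
noncomputable def hDSmooth (h : ℝ) (v : ℝ × R3) (w : {w : ℝ × R3 → ℝ // ContDiff ℝ (⊤ : ℕ∞) w}) :
    {w : ℝ × R3 → ℝ // ContDiff ℝ (⊤ : ℕ∞) w} :=
  ⟨hD h v w, contDiff_hD h v w.2⟩

/-- Multi-indices with vanishing time component are written `Fin.cons 0 α`. -/
theorem hDα_hD (h : ℝ) (α : Fin 3 → ℕ) (i : Fin 3) {w : ℝ × R3 → ℝ}
    (hw : ContDiff ℝ (⊤ : ℕ∞) w) :
    hDα h (Fin.cons 0 α) (hD h (0, e i) w) = hDα h (Fin.cons 0 (α + Pi.single i 1)) w := by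
  have hc : ∀ v v', Function.Commute (hDSmooth h v) (hDSmooth h v') := fun v v' w =>
    Subtype.ext (hD_comm h v v' w.2)
  have hval : ∀ v (n : ℕ) (w : {w : ℝ × R3 → ℝ // ContDiff ℝ (⊤ : ℕ∞) w}),
      (hD h v)^[n] w = ((hDSmooth h v)^[n] w).1 := fun v n w => by
    induction n with
    | zero => rfl
    | succ n ih => rw [Function.iterate_succ_apply', Function.iterate_succ_apply', ih]; rfl
  have hlift : ∀ (α : Fin 4 → ℕ) (w : {w : ℝ × R3 → ℝ // ContDiff ℝ (⊤ : ℕ∞) w}),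
      hDα h α w = ((hDSmooth h (1, 0))^[α 0] ((hDSmooth h (0, e 0))^[α 1]
        ((hDSmooth h (0, e 1))^[α 2] ((hDSmooth h (0, e 2))^[α 3] w)))).1 := fun α w => by
    simp only [hDα, hval]
  have h1 := hlift (Fin.cons 0 α) (hDSmooth h (0, e i) ⟨w, hw⟩)
  have h2 := hlift (Fin.cons 0 (α + Pi.single i 1)) ⟨w, hw⟩
  refine h1.trans (Eq.trans ?_ h2.symm)
  congr 1
  have hmove : ∀ v (n : ℕ) w, (hDSmooth h v)^[n] (hDSmooth h (0, e i) w) =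
      hDSmooth h (0, e i) ((hDSmooth h v)^[n] w) := fun v n w => (hc v _).iterate_left n w
  have hα0 : ∀ β : Fin 3 → ℕ, (Fin.cons 0 β : Fin 4 → ℕ) 0 = 0 := fun _ => rfl
  have hα1 : ∀ β : Fin 3 → ℕ, (Fin.cons 0 β : Fin 4 → ℕ) 1 = β 0 := fun _ => rfl
  have hα2 : ∀ β : Fin 3 → ℕ, (Fin.cons 0 β : Fin 4 → ℕ) 2 = β 1 := fun _ => rfl
  have hα3 : ∀ β : Fin 3 → ℕ, (Fin.cons 0 β : Fin 4 → ℕ) 3 = β 2 := fun _ => rfl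
  simp only [hα0, hα1, hα2, hα3, Function.iterate_zero, id_eq]
  fin_cases i <;>
    simp only [Fin.zero_eta, Fin.mk_one, Fin.reduceFinMk] at hmove ⊢ <;>
    simp [Function.iterate_succ_apply', hmove]

theorem coeffBound_of_hDα {h : ℝ} {M : ℝ≥0} (t : ℝ) {k : ℕ} {w : ℝ × R3 → ℝ}
    (hw : ContDiff ℝ (⊤ : ℕ∞) w)
    (hb : ∀ α : Fin 3 → ℕ, ∑ i, α i ≤ k → ∀ p, |hDα h (Fin.cons 0 α) w p| ≤ M) :
    CoeffBound h M k fun x => w (t, x) := by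
  have h0 : ∀ {w : ℝ × R3 → ℝ}, hDα h (Fin.cons 0 0) w = w := rfl
  induction k generalizing w with
  | zero => exact fun x => by simpa [h0] using hb 0 (by simp) (t, x)
  | succ k ih =>
    refine ⟨fun x => by simpa [h0] using hb 0 (by simp) (t, x), fun i => ?_⟩
    have hd : (fun x => h * fderiv ℝ (fun x => w (t, x)) x (e i)) =
        fun x => hD h (0, e i) w (t, x) := by
      funext x
      have h1 : HasFDerivAt (fun x : R3 => (t, x)) (ContinuousLinearMap.inr ℝ ℝ R3) x :=
        hasFDerivAt_prodMk_right t x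
      have h2 := ((hw.differentiable (by simp) (t, x)).hasFDerivAt).comp x h1
      rw [hD]
      change h * fderiv ℝ (w ∘ fun x => (t, x)) x (e i) = _
      rw [h2.fderiv]
      simp
    rw [hd]
    refine ih (contDiff_hD h _ hw) fun α hα p => ?_
    rw [hDα_hD h α i hw]
    refine hb _ ?_ p
    simp only [Pi.add_apply, Finset.sum_add_distrib, Finset.sum_pi_single', Finset.mem_univ,
      if_true]
    omega

theorem contDiff_hDα (h : ℝ) (α : Fin 4 → ℕ) {w : ℝ × R3 → ℝ} (hw : ContDiff ℝ (⊤ : ℕ∞) w) :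
    ContDiff ℝ (⊤ : ℕ∞) (hDα h α w) := by
  have hit : ∀ v (n : ℕ) {w : ℝ × R3 → ℝ}, ContDiff ℝ (⊤ : ℕ∞) w →
      ContDiff ℝ (⊤ : ℕ∞) ((hD h v)^[n] w) := fun v n w hw => by
    induction n with
    | zero => exact hw
    | succ n ih => rw [Function.iterate_succ_apply']; exact contDiff_hD h v ih
  exact hit _ _ (hit _ _ (hit _ _ (hit _ _ hw)))

/-- Families in `C^∞_h` give coefficients on `ℝ³` which are bounded uniformly in `t` and `h`. -/
theorem MemCInf.exists_coeffBound {A : ℝ → ℝ × R3 → Matrix (Fin 3) (Fin 3) ℝ} (hA : MemCInf A)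
    (k : ℕ) : ∃ M : ℝ≥0, 0 < M ∧ ∀ h ∈ Set.Ioo (0 : ℝ) 1, ∀ t i j,
      CoeffBound h M k fun x => A h (t, x) i j := by
  let M : ℝ≥0 := 1 + ∑ i, ∑ j, (CkNorm k fun h p => A h p i j).toNNReal
  refine ⟨M, by positivity, fun h hh t i j => ?_⟩
  have hsm : ContDiff ℝ (⊤ : ℕ∞) fun p => A h p i j :=
    contDiff_infty.2 fun n => (hA n i j).1 h hh
  refine coeffBound_of_hDα t hsm fun α hα =>
    abs_le_of_eLpNorm_top_le (contDiff_hDα h _ hsm).continuous ?_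
  have h1 : eLpNorm (hDα h (Fin.cons 0 α) fun p => A h p i j) ⊤ volume ≤
      CkNorm k fun h p => A h p i j := by
    refine le_trans ?_ (le_iSup₂ (f := fun h (_ : h ∈ Set.Ioo (0 : ℝ) 1) =>
      ∑ α ∈ multiIndices 4 k, eLpNorm (hDα h α fun p => A h p i j) ⊤ volume) h hh)
    refine Finset.single_le_sum (f := fun α => eLpNorm (hDα h α fun p => A h p i j) ⊤ volume)
      (fun _ _ => zero_le) (mem_multiIndices.2 ?_)
    simpa [Fin.sum_univ_succ] using hα
  refine h1.trans ?_
  rw [← ENNReal.coe_toNNReal (hA k i j).2.ne, ENNReal.coe_le_coe]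
  refine le_trans ?_ le_add_self
  refine le_trans ?_ (Finset.single_le_sum
    (f := fun i => ∑ j, (CkNorm k fun h p => A h p i j).toNNReal)
    (fun _ _ => zero_le) (Finset.mem_univ i))
  exact Finset.single_le_sum (f := fun j => (CkNorm k fun h p => A h p i j).toNNReal)
    (fun _ _ => zero_le) (Finset.mem_univ j)

theorem MemCInf.hasTemperateGrowth {A : ℝ → ℝ × R3 → Matrix (Fin 3) (Fin 3) ℝ} (hA : MemCInf A)
    {h : ℝ} (hh : h ∈ Set.Ioo (0 : ℝ) 1) (t : ℝ) (i j : Fin 3) :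
    (fun x => A h (t, x) i j).HasTemperateGrowth := by
  have hsm : ContDiff ℝ (⊤ : ℕ∞) fun p => A h p i j :=
    contDiff_infty.2 fun n => (hA n i j).1 h hh
  refine hasTemperateGrowth_of_coeffBound hh.1.ne' (hsm.comp (contDiff_prodMk_right t)) fun k => ?_
  obtain ⟨M, -, hM⟩ := hA.exists_coeffBound k
  exact ⟨M, hM h hh t i j⟩

/-! ### The pairing and the `L²` norm of Schwartz functions -/

/-- The bilinear pairing `⟨f, g⟩ = ∫ f g` of Schwartz functions. -/
noncomputable def pair : 𝓢(R3, ℂ) →ₗ[ℂ] 𝓢(R3, ℂ) →ₗ[ℂ] ℂ :=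
  LinearMap.mk₂ ℂ (fun f g => (f : 𝓢'(R3, ℂ)) g) (fun f f' g => by rw [map_add]; rfl)
    (fun c f g => by rw [map_smul]; rfl) (fun f g g' => map_add _ g g')
    (fun c f g => map_smul _ c g)

theorem pair_eq_coe (f g : 𝓢(R3, ℂ)) : pair f g = (f : 𝓢'(R3, ℂ)) g := rfl

theorem pair_eq_integral (f g : 𝓢(R3, ℂ)) : pair f g = ∫ x, g x * f x := by
  rw [pair_eq_coe, SchwartzMap.coe_apply]
  rfl

theorem pair_hDS (h : ℝ) (i : Fin 3) (f g : 𝓢(R3, ℂ)) :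
    pair (hDS h i f) g = -pair f (hDS h i g) := by
  rw [pair_eq_coe, ← hDx_toTemperedDistribution, hDx_apply, pair_eq_coe]

/-- The `L²` norm of a Schwartz function. -/
noncomputable def normL2 (f : 𝓢(R3, ℂ)) : ℝ := ‖f.toLp 2 volume‖

theorem normL2_nonneg (f : 𝓢(R3, ℂ)) : 0 ≤ normL2 f := norm_nonneg _

theorem normL2_add_le (f g : 𝓢(R3, ℂ)) : normL2 (f + g) ≤ normL2 f + normL2 g :=
  norm_add_le (f.toLp 2 volume) (g.toLp 2 volume)

theorem normL2_sub_le (f g : 𝓢(R3, ℂ)) : normL2 (f - g) ≤ normL2 f + normL2 g :=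
  norm_sub_le (f.toLp 2 volume) (g.toLp 2 volume)

theorem normL2_zero : normL2 0 = 0 := by
  rw [normL2, ← SchwartzMap.toLpCLM_apply (𝕜 := ℝ), map_zero, norm_zero]

theorem normL2_sum_le {ι : Type*} (s : Finset ι) (f : ι → 𝓢(R3, ℂ)) :
    normL2 (∑ i ∈ s, f i) ≤ ∑ i ∈ s, normL2 (f i) :=
  Finset.le_sum_of_subadditive _ normL2_zero.le normL2_add_le s f

theorem norm_apply_le (f : Lp ℂ 2 (volume : Measure R3)) (φ : 𝓢(R3, ℂ)) :
    ‖(f : 𝓢'(R3, ℂ)) φ‖ ≤ ‖f‖ * normL2 φ := by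
  have := enorm_apply_le f φ
  rw [← ofReal_norm, ← ofReal_norm, ← ofReal_norm, ← ENNReal.ofReal_mul (norm_nonneg _)] at this
  exact (ENNReal.ofReal_le_ofReal_iff (mul_nonneg (norm_nonneg _) (norm_nonneg _))).1 this

theorem norm_pair_le (f g : 𝓢(R3, ℂ)) : ‖pair f g‖ ≤ normL2 f * normL2 g := by
  rw [pair_eq_coe, ← Lp.toTemperedDistribution_toLp_eq (p := 2)]
  exact norm_apply_le _ g

/-- The complex conjugate of a Schwartz function. -/
noncomputable def conjS (f : 𝓢(R3, ℂ)) : 𝓢(R3, ℂ) :=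
  SchwartzMap.postcompCLM (Complex.conjCLE : ℂ →L[ℝ] ℂ) f

theorem conjS_apply (f : 𝓢(R3, ℂ)) (x : R3) : conjS f x = starRingEnd ℂ (f x) := rfl

theorem conjS_conjS (f : 𝓢(R3, ℂ)) : conjS (conjS f) = f := by
  ext x
  simp [conjS_apply]

theorem hDS_conjS (h : ℝ) (i : Fin 3) (f : 𝓢(R3, ℂ)) : hDS h i (conjS f) = conjS (hDS h i f) := by
  ext x
  have h1 : HasFDerivAt (conjS f) ((Complex.conjCLE : ℂ →L[ℝ] ℂ) ∘L fderiv ℝ f x) x :=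
    (Complex.conjCLE : ℂ →L[ℝ] ℂ).hasFDerivAt.comp x (f.hasFDerivAt x)
  rw [hDS_eq, hDS_eq, conjS_apply, _root_.smul_apply, _root_.smul_apply,
    SchwartzMap.lineDerivOp_apply_eq_fderiv, SchwartzMap.lineDerivOp_apply_eq_fderiv, h1.fderiv]
  simp

theorem conjS_sub (f g : 𝓢(R3, ℂ)) : conjS (f - g) = conjS f - conjS g := map_sub _ f g

theorem pair_conjS_conjS (f g : 𝓢(R3, ℂ)) :
    pair (conjS f) (conjS g) = starRingEnd ℂ (pair f g) := by
  rw [pair_eq_integral, pair_eq_integral, ← integral_conj]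
  simp [conjS_apply]

theorem pair_conjS_self (f : 𝓢(R3, ℂ)) : pair f (conjS f) = (normL2 f ^ 2 : ℝ) := by
  have h1 := SchwartzMap.inner_toL2_toL2_eq f f
  rw [inner_self_eq_norm_sq_to_K] at h1
  rw [pair_eq_integral, normL2]
  push_cast
  refine Eq.trans ?_ h1.symm
  refine integral_congr_ae (ae_of_all _ fun x => ?_)
  simp only [conjS_apply, RCLike.inner_apply]
  ring

theorem normL2_conjS (f : 𝓢(R3, ℂ)) : normL2 (conjS f) = normL2 f := by
  have h1 := pair_conjS_self (conjS f)
  rw [pair_conjS_conjS, pair_conjS_self, Complex.conj_ofReal] at h1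
  exact ((sq_eq_sq₀ (normL2_nonneg _) (normL2_nonneg _)).1 (by exact_mod_cast h1)).symm

/-- The norm of `H^1_h(ℝ³)` for Schwartz functions, in additive form. -/
noncomputable def normH1 (h : ℝ) (f : 𝓢(R3, ℂ)) : ℝ := normL2 f + ∑ i, normL2 (hDS h i f)

theorem normH1_nonneg (h : ℝ) (f : 𝓢(R3, ℂ)) : 0 ≤ normH1 h f :=
  add_nonneg (normL2_nonneg f) (Finset.sum_nonneg fun _ _ => normL2_nonneg _)

theorem normL2_le_normH1 (h : ℝ) (f : 𝓢(R3, ℂ)) : normL2 f ≤ normH1 h f :=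
  le_add_of_nonneg_right (Finset.sum_nonneg fun _ _ => normL2_nonneg _)

theorem normL2_hDS_le_normH1 (h : ℝ) (i : Fin 3) (f : 𝓢(R3, ℂ)) :
    normL2 (hDS h i f) ≤ normH1 h f :=
  (Finset.single_le_sum (f := fun i => normL2 (hDS h i f)) (fun _ _ => normL2_nonneg _)
    (Finset.mem_univ i)).trans (le_add_of_nonneg_left (normL2_nonneg f))

theorem normH1_add_le (h : ℝ) (f g : 𝓢(R3, ℂ)) : normH1 h (f + g) ≤ normH1 h f + normH1 h g := by
  simp only [normH1, map_add, Fin.sum_univ_three]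
  linarith [normL2_add_le f g, normL2_add_le (hDS h 0 f) (hDS h 0 g),
    normL2_add_le (hDS h 1 f) (hDS h 1 g), normL2_add_le (hDS h 2 f) (hDS h 2 g)]

theorem normH1_zero (h : ℝ) : normH1 h 0 = 0 := by
  simp [normH1, normL2_zero]

theorem normH1_sum_le (h : ℝ) {ι : Type*} (s : Finset ι) (f : ι → 𝓢(R3, ℂ)) :
    normH1 h (∑ i ∈ s, f i) ≤ ∑ i ∈ s, normH1 h (f i) :=
  Finset.le_sum_of_subadditive _ (normH1_zero h).le (normH1_add_le h) s f

theorem normH1_conjS (h : ℝ) (f : 𝓢(R3, ℂ)) : normH1 h (conjS f) = normH1 h f := by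
  simp only [normH1, hDS_conjS, normL2_conjS]

/-! ### The resolvent `(1 - h²Δ)⁻¹` -/

/-- The operator `(1 - h²Δ)⁻¹` on Schwartz functions, as the Fourier multiplier with symbol
`(1 + (2πh)²|ξ|²)⁻¹`; the powers of `2π` come from the normalization of the Fourier transform. -/
noncomputable def resolvent (h : ℝ) : 𝓢(R3, ℂ) →L[ℂ] 𝓢(R3, ℂ) :=
  SchwartzMap.fourierMultiplierCLM ℂ
    fun x : R3 => (((1 + ‖(2 * Real.pi * h) • x‖ ^ 2) ^ (-1 : ℝ) : ℝ) : ℂ)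

theorem hasTemperateGrowth_resolvent_symbol (h : ℝ) :
    (fun x : R3 => (((1 + ‖(2 * Real.pi * h) • x‖ ^ 2) ^ (-1 : ℝ) : ℝ) : ℂ)).HasTemperateGrowth :=
  Function.Complex.hasTemperateGrowth_ofReal.comp
    ((Function.hasTemperateGrowth_one_add_norm_sq_rpow R3 (-1)).comp
      ((2 * Real.pi * h) • ContinuousLinearMap.id ℝ R3).hasTemperateGrowth)

theorem resolvent_hDS (h : ℝ) (i : Fin 3) (f : 𝓢(R3, ℂ)) :
    resolvent h (hDS h i f) = hDS h i (resolvent h f) := by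
  simp only [hDS_eq_fourierMultiplierCLM, map_smul, resolvent]
  rw [SchwartzMap.fourierMultiplierCLM_fourierMultiplierCLM_apply
      (hasTemperateGrowth_resolvent_symbol h) (by fun_prop),
    SchwartzMap.fourierMultiplierCLM_fourierMultiplierCLM_apply (by fun_prop)
      (hasTemperateGrowth_resolvent_symbol h), mul_comm (fun x : R3 => ((inner ℝ x (e i) : ℝ) : ℂ))]

theorem fourierMultiplierCLM_sub_one {σ : R3 → ℂ} (hσ : σ.HasTemperateGrowth) (f : 𝓢(R3, ℂ)) :
    SchwartzMap.fourierMultiplierCLM ℂ (fun x => σ x - 1) f =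
      SchwartzMap.fourierMultiplierCLM ℂ σ f - f := by
  have h1 : (fun x => σ x - 1) =
      fun x => ∑ i : Fin 2, (![σ, fun _ => -1] : Fin 2 → R3 → ℂ) i x := by
    funext x
    simp [sub_eq_add_neg]
  rw [h1, SchwartzMap.fourierMultiplierCLM_sum ℂ fun i _ => by
    fin_cases i
    · exact hσ
    · exact Function.HasTemperateGrowth.const (-1)]
  simp [sub_eq_add_neg]

/-- The defining equation `(1 - h²Δ) (1 - h²Δ)⁻¹ f = f`. -/
theorem resolvent_sub_sum (h : ℝ) (f : 𝓢(R3, ℂ)) :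
    resolvent h f - ∑ i, hDS h i (hDS h i (resolvent h f)) = f := by
  let σ : R3 → ℂ := fun x => (((1 + ‖(2 * Real.pi * h) • x‖ ^ 2) ^ (-1 : ℝ) : ℝ) : ℂ)
  have hσ : σ.HasTemperateGrowth := hasTemperateGrowth_resolvent_symbol h
  let ℓ : Fin 3 → R3 → ℂ := fun i x => ((inner ℝ x (e i) : ℝ) : ℂ)
  have hℓ : ∀ i, (ℓ i).HasTemperateGrowth := fun i => by fun_prop
  set c : ℂ := (h : ℂ) * (2 * (Real.pi : ℂ) * Complex.I) with hc
  have h1 : ∀ i, hDS h i (hDS h i (resolvent h f)) =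
      SchwartzMap.fourierMultiplierCLM ℂ ((c * c) • (ℓ i * (ℓ i * σ))) f := fun i => by
    simp only [hDS_eq_fourierMultiplierCLM, map_smul, resolvent]
    rw [SchwartzMap.fourierMultiplierCLM_fourierMultiplierCLM_apply (hℓ i) hσ,
      SchwartzMap.fourierMultiplierCLM_fourierMultiplierCLM_apply (hℓ i) ((hℓ i).mul hσ),
      SchwartzMap.fourierMultiplierCLM_smul ((hℓ i).mul ((hℓ i).mul hσ)), smul_smul]
    rfl
  simp only [h1]
  have h2 : ∀ i, ((c * c) • (ℓ i * (ℓ i * σ))).HasTemperateGrowth := fun i =>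
    (Function.HasTemperateGrowth.const (c * c)).mul ((hℓ i).mul ((hℓ i).mul hσ))
  have h3 : ∑ i, SchwartzMap.fourierMultiplierCLM ℂ ((c * c) • (ℓ i * (ℓ i * σ))) f =
      SchwartzMap.fourierMultiplierCLM ℂ (fun x => ∑ i, ((c * c) • (ℓ i * (ℓ i * σ))) x) f := by
    rw [SchwartzMap.fourierMultiplierCLM_sum ℂ (fun i _ => h2 i), _root_.sum_apply]
  have h4 : (fun x => ∑ i, ((c * c) • (ℓ i * (ℓ i * σ))) x) = fun x => σ x - 1 := by
    funext x
    have hn : ‖x‖ ^ 2 = ∑ i, (inner ℝ x (e i)) ^ 2 := by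
      rw [EuclideanSpace.norm_sq_eq]
      simp [e, EuclideanSpace.inner_single_right]
    have hpos : (1 + (2 * Real.pi * h) ^ 2 * ‖x‖ ^ 2 : ℝ) ≠ 0 := by positivity
    have hσx : σ x = ((1 + (2 * Real.pi * h) ^ 2 * ‖x‖ ^ 2 : ℝ) : ℂ)⁻¹ := by
      simp only [σ]
      rw [Real.rpow_neg_one, norm_smul, mul_pow, Real.norm_eq_abs, sq_abs]
      push_cast
      rfl
    have hcc : c * c = -((2 * Real.pi * h) ^ 2 : ℝ) := by
      rw [hc]
      push_cast
      linear_combination (4 * (h : ℂ) ^ 2 * (Real.pi : ℂ) ^ 2) * Complex.I_mul_I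
    have hs : ∑ i, ((c * c) • (ℓ i * (ℓ i * σ))) x = c * c * (‖x‖ ^ 2 : ℝ) * σ x := by
      rw [hn]
      push_cast
      rw [Finset.mul_sum, Finset.sum_mul]
      refine Finset.sum_congr rfl fun i _ => ?_
      simp only [Pi.smul_apply, Pi.mul_apply, smul_eq_mul, ℓ]
      ring
    rw [hs, hσx, hcc]
    norm_cast
    field_simp
    ring
  rw [h3, h4, fourierMultiplierCLM_sub_one hσ]
  exact sub_sub_cancel _ _

/-- Integration by parts in `⟨(1 - h²Δ) g, conj g⟩`. -/
theorem energy_identity (h : ℝ) (g : 𝓢(R3, ℂ)) :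
    pair (g - ∑ i, hDS h i (hDS h i g)) (conjS g) =
      ((normL2 g ^ 2 + ∑ i, normL2 (hDS h i g) ^ 2 : ℝ) : ℂ) := by
  rw [map_sub, LinearMap.sub_apply, map_sum, LinearMap.sum_apply]
  simp only [pair_hDS h _ (hDS h _ g), hDS_conjS, pair_conjS_self]
  push_cast
  rw [Finset.sum_neg_distrib, sub_neg_eq_add]

theorem normH1_resolvent_sq_le (h : ℝ) (f : 𝓢(R3, ℂ)) :
    normH1 h (resolvent h f) ^ 2 ≤ 4 * ‖pair f (conjS (resolvent h f))‖ := by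
  have h1 := energy_identity h (resolvent h f)
  rw [resolvent_sub_sum] at h1
  rw [h1, Complex.norm_real, Real.norm_of_nonneg (by positivity), normH1, Fin.sum_univ_three,
    Fin.sum_univ_three]
  set a := normL2 (resolvent h f)
  set b := fun i => normL2 (hDS h i (resolvent h f))
  nlinarith [sq_nonneg (a - b 0), sq_nonneg (a - b 1), sq_nonneg (a - b 2), sq_nonneg (b 0 - b 1),
    sq_nonneg (b 0 - b 2), sq_nonneg (b 1 - b 2)]

theorem le_of_sq_le_mul {x C : ℝ} (hx : 0 ≤ x) (hC : 0 ≤ C) (h : x ^ 2 ≤ C * x) : x ≤ C := by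
  rcases hx.eq_or_lt with rfl | hx
  · exact hC
  · exact le_of_mul_le_mul_right (by rwa [← sq]) hx

/-- The resolvent is bounded from `H^{-1}_h` to `H^1_h`, uniformly in `h`. The hypothesis says that
the dual norm of `f` is at most `a`. -/
theorem normH1_resolvent_le {h a : ℝ} (ha : 0 ≤ a) {f : 𝓢(R3, ℂ)}
    (hf : ∀ φ, ‖pair f φ‖ ≤ a * normH1 h φ) : normH1 h (resolvent h f) ≤ 4 * a := by
  refine le_of_sq_le_mul (normH1_nonneg h _) (by positivity)
    ((normH1_resolvent_sq_le h f).trans ?_)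
  have := hf (conjS (resolvent h f))
  rw [normH1_conjS] at this
  linarith

/-- The operators `h ∂_i (1 - h²Δ)⁻¹` are bounded from `L²` to `H^1_h`, because `h ∂_i` maps `L²` to
`H^{-1}_h`. -/
theorem normH1_hDS_resolvent_le (h : ℝ) (i : Fin 3) (f : 𝓢(R3, ℂ)) :
    normH1 h (hDS h i (resolvent h f)) ≤ 4 * normL2 f := by
  rw [← resolvent_hDS]
  refine normH1_resolvent_le (normL2_nonneg f) fun φ => ?_
  rw [pair_hDS, norm_neg]
  exact (norm_pair_le _ _).trans (by
    gcongr
    · exact normL2_nonneg f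
    · exact normL2_hDS_le_normH1 h i φ)

/-! ### The estimate at order zero -/

/-- `A` is a matrix of coefficients of temperate growth with entries bounded by `M`, and
`A ≥ c I`. -/
structure IsElliptic (c M : ℝ≥0) (A : R3 → Matrix (Fin 3) (Fin 3) ℝ) : Prop where
  growth : ∀ i j, (fun x => A x i j).HasTemperateGrowth
  bound : ∀ i j x, |A x i j| ≤ M
  coercive : ∀ x (v : Fin 3 → ℝ), c * (v ⬝ᵥ v) ≤ v ⬝ᵥ (A x *ᵥ v)

theorem IsElliptic.growth_ofReal {c M : ℝ≥0} {A : R3 → Matrix (Fin 3) (Fin 3) ℝ}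
    (hA : IsElliptic c M A) (i j : Fin 3) : (fun x => (A x i j : ℂ)).HasTemperateGrowth :=
  Function.Complex.hasTemperateGrowth_ofReal.comp (hA.growth i j)

/-- The product `A S` of a matrix function with a Schwartz field. -/
noncomputable def mulFieldS (A : R3 → Matrix (Fin 3) (Fin 3) ℝ) (S : Fin 3 → 𝓢(R3, ℂ)) :
    Fin 3 → 𝓢(R3, ℂ) :=
  fun i => ∑ j, SchwartzMap.smulLeftCLM ℂ (fun x => (A x i j : ℂ)) (S j)

theorem smulLeftCLM_toTemperedDistribution {a : R3 → ℂ} (ha : a.HasTemperateGrowth)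
    (f : 𝓢(R3, ℂ)) : TemperedDistribution.smulLeftCLM ℂ a (f : 𝓢'(R3, ℂ)) =
      (SchwartzMap.smulLeftCLM ℂ a f : 𝓢(R3, ℂ)) := by
  ext φ
  rw [TemperedDistribution.smulLeftCLM_apply_apply, SchwartzMap.coe_apply, SchwartzMap.coe_apply]
  refine integral_congr_ae (ae_of_all _ fun x => ?_)
  simp only [SchwartzMap.smulLeftCLM_apply_apply ha, smul_eq_mul]
  ring

theorem mulField_toTemperedDistribution {c M : ℝ≥0} {A : R3 → Matrix (Fin 3) (Fin 3) ℝ}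
    (hA : IsElliptic c M A) (S : Fin 3 → 𝓢(R3, ℂ)) (i : Fin 3) :
    mulField A (fun j => (S j : 𝓢'(R3, ℂ))) i = (mulFieldS A S i : 𝓢(R3, ℂ)) := by
  simp only [mulField, mulFieldS, smulLeftCLM_toTemperedDistribution (hA.growth_ofReal _ _),
    map_sum]

theorem normL2_smulLeftCLM_le {a : R3 → ℝ} (ha : a.HasTemperateGrowth) {M : ℝ≥0} (hM : 0 < M)
    (hb : ∀ x, |a x| ≤ M) (f : 𝓢(R3, ℂ)) :
    normL2 (SchwartzMap.smulLeftCLM ℂ (fun x => (a x : ℂ)) f) ≤ M * normL2 f := by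
  have hc : (fun x => (a x : ℂ)).HasTemperateGrowth :=
    Function.Complex.hasTemperateGrowth_ofReal.comp ha
  have h1 := l2Norm_smulLeftCLM_le hc hM (fun x => by simpa using hb x) (f : 𝓢'(R3, ℂ))
  rw [smulLeftCLM_toTemperedDistribution hc, l2Norm_toTemperedDistribution,
    l2Norm_toTemperedDistribution] at h1
  have h2 := ENNReal.toReal_mono (ENNReal.mul_ne_top ENNReal.coe_ne_top enorm_ne_top) h1
  simpa [normL2] using h2

theorem normL2_mulFieldS_le {c M : ℝ≥0} (hM : 0 < M) {A : R3 → Matrix (Fin 3) (Fin 3) ℝ}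
    (hA : IsElliptic c M A) (S : Fin 3 → 𝓢(R3, ℂ)) (i : Fin 3) :
    normL2 (mulFieldS A S i) ≤ M * ∑ j, normL2 (S j) := by
  rw [Finset.mul_sum]
  exact (normL2_sum_le _ _).trans (Finset.sum_le_sum fun j _ =>
    normL2_smulLeftCLM_le (hA.growth i j) hM (hA.bound i j) (S j))

/-- A lower bound for a real quadratic form carries over to complex vectors. -/
theorem re_conj_mul_ge {A : Matrix (Fin 3) (Fin 3) ℝ} {c : ℝ}
    (hA : ∀ v : Fin 3 → ℝ, c * (v ⬝ᵥ v) ≤ v ⬝ᵥ (A *ᵥ v)) (z : Fin 3 → ℂ) :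
    0 ≤ (∑ i, starRingEnd ℂ (z i) * (∑ j, (A i j : ℂ) * z j - c * z i)).re := by
  have h1 := hA fun i => (z i).re
  have h2 := hA fun i => (z i).im
  simp only [dotProduct, mulVec, Fin.sum_univ_three] at h1 h2
  simp [Fin.sum_univ_three]
  nlinarith

/-- The form `⟨A S, conj S⟩` is bounded below by `c ‖S‖²`. -/
theorem coercive_pair {c M : ℝ≥0} {A : R3 → Matrix (Fin 3) (Fin 3) ℝ} (hA : IsElliptic c M A)
    (S : Fin 3 → 𝓢(R3, ℂ)) :
    c * ∑ i, normL2 (S i) ^ 2 ≤ (∑ i, pair (mulFieldS A S i) (conjS (S i))).re := by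
  have h1 : ∑ i, pair (mulFieldS A S i) (conjS (S i)) - ((c * ∑ i, normL2 (S i) ^ 2 : ℝ) : ℂ) =
      ∑ i, pair (mulFieldS A S i - (c : ℂ) • S i) (conjS (S i)) := by
    simp only [map_sub, map_smul, LinearMap.sub_apply, LinearMap.smul_apply, pair_conjS_self,
      Finset.sum_sub_distrib, smul_eq_mul, ← Finset.mul_sum]
    push_cast
    rfl
  have hint : ∀ i, Integrable (fun x =>
      starRingEnd ℂ (S i x) * (∑ j, (A x i j : ℂ) * S j x - c * S i x)) volume := fun i => by
    refine ((SchwartzMap.pairing (ContinuousLinearMap.lsmul ℂ ℂ) (conjS (S i))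
      (mulFieldS A S i - (c : ℂ) • S i)).integrable).congr (ae_of_all _ fun x => ?_)
    simp only [SchwartzMap.pairing_apply_apply, ContinuousLinearMap.lsmul_apply, conjS_apply,
      mulFieldS, _root_.sub_apply, _root_.smul_apply, _root_.sum_apply,
      SchwartzMap.smulLeftCLM_apply_apply (hA.growth_ofReal _ _), smul_eq_mul]
  have h2 : ∑ i, pair (mulFieldS A S i - (c : ℂ) • S i) (conjS (S i)) =
      ∫ x, ∑ i, starRingEnd ℂ (S i x) * (∑ j, (A x i j : ℂ) * S j x - c * S i x) := by
    rw [integral_finsetSum _ fun i _ => hint i]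
    refine Finset.sum_congr rfl fun i _ => ?_
    rw [pair_eq_integral]
    refine integral_congr_ae (ae_of_all _ fun x => ?_)
    simp only [conjS_apply, mulFieldS, _root_.sub_apply, _root_.smul_apply, _root_.sum_apply,
      SchwartzMap.smulLeftCLM_apply_apply (hA.growth_ofReal _ _), smul_eq_mul]
  have h3 : 0 ≤ (∑ i, pair (mulFieldS A S i) (conjS (S i)) -
      ((c * ∑ i, normL2 (S i) ^ 2 : ℝ) : ℂ)).re := by
    rw [h1, h2, ← Complex.reCLM_apply, ← ContinuousLinearMap.integral_comp_comm _
      (integrable_finsetSum _ fun i _ => hint i)]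
    exact integral_nonneg fun x => re_conj_mul_ge (hA.coercive x) fun i => S i x
  rw [Complex.sub_re, Complex.ofReal_re] at h3
  linarith

/-- A field splits into a smoothing term, a term which depends only on its curl, and a gradient. -/
theorem helmholtz_decomposition (h : ℝ) (F : Fin 3 → 𝓢(R3, ℂ)) (i : Fin 3) :
    F i = resolvent h (F i) - ∑ k, hDS h k (resolvent h (hDS h k (F i) - hDS h i (F k))) -
      hDS h i (∑ k, hDS h k (resolvent h (F k))) := by
  have h1 : ∑ k, hDS h k (resolvent h (hDS h k (F i) - hDS h i (F k))) =
      ∑ k, hDS h k (hDS h k (resolvent h (F i))) - hDS h i (∑ k, hDS h k (resolvent h (F k))) := by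
    simp only [map_sub, map_sum, resolvent_hDS, Finset.sum_sub_distrib]
    congr 1
    exact Finset.sum_congr rfl fun k _ => hDS_comm h k i _
  rw [h1]
  nth_rewrite 1 [← resolvent_sub_sum h (F i)]
  abel

/-- The estimate at order zero for Schwartz fields; `α`, `β` and `δ` bound the dual norms of
`h curl S`, `h div (A S)` and `S`. -/
theorem sum_normL2_le {c M : ℝ≥0} (hc : 0 < c) (hM : 0 < M)
    {A : R3 → Matrix (Fin 3) (Fin 3) ℝ} (hA : IsElliptic c M A) {h : ℝ} {S : Fin 3 → 𝓢(R3, ℂ)}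
    {α β δ : ℝ} (hα : 0 ≤ α) (hβ : 0 ≤ β) (hδ : 0 ≤ δ)
    (hcurl : ∀ k i φ, ‖pair (hDS h k (S i) - hDS h i (S k)) φ‖ ≤ α * normH1 h φ)
    (hdiv : ∀ φ, ‖pair (∑ i, hDS h i (mulFieldS A S i)) φ‖ ≤ β * normH1 h φ)
    (hS : ∀ i φ, ‖pair (S i) φ‖ ≤ δ * normH1 h φ) :
    ∑ i, normL2 (S i) ≤ 3 / c * (36 * M * α + 4 * β + 12 * M * δ) := by
  set N := ∑ i, normL2 (S i) with hN
  have hN0 : 0 ≤ N := Finset.sum_nonneg fun _ _ => normL2_nonneg _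
  set u := mulFieldS A S with hu
  let F : Fin 3 → 𝓢(R3, ℂ) := fun i => conjS (S i)
  have conj_bound : ∀ {f : 𝓢(R3, ℂ)} {a : ℝ}, (∀ φ, ‖pair f φ‖ ≤ a * normH1 h φ) →
      ∀ φ, ‖pair (conjS f) φ‖ ≤ a * normH1 h φ := fun {f a} hf φ => by
    rw [← conjS_conjS φ, pair_conjS_conjS, RCLike.norm_conj, normH1_conjS]
    exact hf _
  let V : Fin 3 → 𝓢(R3, ℂ) := fun i => resolvent h (F i) -
    ∑ k, hDS h k (resolvent h (hDS h k (F i) - hDS h i (F k)))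
  have hV : ∀ i, normL2 (V i) ≤ 4 * δ + 12 * α := fun i => by
    have h1 : normL2 (resolvent h (F i)) ≤ 4 * δ :=
      (normL2_le_normH1 h _).trans (normH1_resolvent_le hδ (conj_bound (hS i)))
    have h2 : ∀ k, normL2 (hDS h k (resolvent h (hDS h k (F i) - hDS h i (F k)))) ≤ 4 * α :=
      fun k => by
        refine (normL2_hDS_le_normH1 h k _).trans (normH1_resolvent_le hα ?_)
        simp only [F, hDS_conjS, ← conjS_sub]
        exact conj_bound (hcurl k i)
    refine (normL2_sub_le _ _).trans ?_
    have h3 := (normL2_sum_le Finset.univ fun k =>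
      hDS h k (resolvent h (hDS h k (F i) - hDS h i (F k)))).trans
        (Finset.sum_le_sum fun k _ => h2 k)
    simp only [Finset.sum_const, Finset.card_univ, Fintype.card_fin, nsmul_eq_mul] at h3
    push_cast at h3
    linarith
  let D : 𝓢(R3, ℂ) := ∑ k, hDS h k (resolvent h (F k))
  have hD : normH1 h D ≤ 4 * N := by
    rw [hN, Finset.mul_sum]
    refine (normH1_sum_le h _ _).trans (Finset.sum_le_sum fun k _ => ?_)
    refine (normH1_hDS_resolvent_le h k (F k)).trans_eq ?_
    rw [normL2_conjS]
  -- The gradient part of `F` is moved onto `u = A S` by parts, so that it only sees `div (A S)`.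
  have hsplit : ∑ i, pair (u i) (F i) = ∑ i, pair (u i) (V i) + pair (∑ i, hDS h i (u i)) D := by
    rw [map_sum pair, LinearMap.sum_apply, ← Finset.sum_add_distrib]
    refine Finset.sum_congr rfl fun i _ => ?_
    rw [pair_hDS, ← sub_eq_add_neg, ← map_sub]
    congr 1
    exact helmholtz_decomposition h F i
  have hle : ‖∑ i, pair (u i) (F i)‖ ≤ N * (36 * M * α + 4 * β + 12 * M * δ) := by
    rw [hsplit]
    have h1 : ∀ i, ‖pair (u i) (V i)‖ ≤ M * N * (4 * δ + 12 * α) := fun i =>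
      (norm_pair_le _ _).trans (mul_le_mul (normL2_mulFieldS_le hM hA S i) (hV i)
        (normL2_nonneg _) (by positivity))
    have h2 : ‖∑ i, pair (u i) (V i)‖ ≤ 3 * (M * N * (4 * δ + 12 * α)) := by
      refine (norm_sum_le _ _).trans ((Finset.sum_le_sum fun i _ => h1 i).trans_eq ?_)
      simp
    have h3 : ‖pair (∑ i, hDS h i (u i)) D‖ ≤ β * (4 * N) :=
      (hdiv D).trans (by gcongr)
    refine (norm_add_le _ _).trans ((add_le_add h2 h3).trans_eq ?_)
    ring
  have hlow : c * (N ^ 2 / 3) ≤ N * (36 * M * α + 4 * β + 12 * M * δ) := by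
    refine le_trans ?_ ((coercive_pair hA S).trans ((Complex.re_le_norm _).trans hle))
    gcongr
    rw [hN, Fin.sum_univ_three, Fin.sum_univ_three]
    nlinarith [sq_nonneg (normL2 (S 0) - normL2 (S 1)), sq_nonneg (normL2 (S 0) - normL2 (S 2)),
      sq_nonneg (normL2 (S 1) - normL2 (S 2))]
  have hc' : (0 : ℝ) < c := hc
  refine le_of_sq_le_mul hN0 (by positivity) ?_
  rw [div_mul_eq_mul_div, div_mul_eq_mul_div, le_div_iff₀ hc']
  linarith

/-- Extension of the estimate at order zero from Schwartz fields to `L²` fields by density. -/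
theorem sum_norm_le {c M : ℝ≥0} (hc : 0 < c) (hM : 0 < M)
    {A : R3 → Matrix (Fin 3) (Fin 3) ℝ} (hA : IsElliptic c M A) {h : ℝ}
    {f : Fin 3 → Lp ℂ 2 (volume : Measure R3)}
    {α β δ : ℝ} (hα : 0 ≤ α) (hβ : 0 ≤ β) (hδ : 0 ≤ δ)
    (hcurl : ∀ k i φ, ‖(hDx h k (f i : 𝓢'(R3, ℂ)) - hDx h i (f k : 𝓢'(R3, ℂ))) φ‖ ≤
      α * normH1 h φ)
    (hdiv : ∀ φ, ‖(∑ i, hDx h i (mulField A (fun j => (f j : 𝓢'(R3, ℂ))) i)) φ‖ ≤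
      β * normH1 h φ)
    (hf : ∀ i φ, ‖(f i : 𝓢'(R3, ℂ)) φ‖ ≤ δ * normH1 h φ) :
    ∑ i, ‖f i‖ ≤ 3 / c * (36 * M * α + 4 * β + 12 * M * δ) := by
  set K : ℝ := 3 / c * (36 * M * 2 + 4 * (9 * M) + 12 * M) + 3 with hK
  have hK0 : 0 < K := by positivity
  refine le_of_forall_pos_le_add fun η hη => ?_
  set r := η / K with hr
  have hr0 : 0 < r := by positivity
  have hex : ∀ i, ∃ S : 𝓢(R3, ℂ), ‖f i - S.toLp 2 volume‖ < r := fun i => by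
    obtain ⟨S, hS⟩ := (SchwartzMap.denseRange_toLpCLM (E := R3) (F := ℂ) (p := 2)
      (μ := volume) (by simp)).exists_dist_lt (f i) hr0
    exact ⟨S, by rwa [dist_eq_norm] at hS⟩
  choose S hS using hex
  -- The error field, whose pairings with test functions are small.
  let g : Fin 3 → Lp ℂ 2 (volume : Measure R3) := fun i => f i - (S i).toLp 2 volume
  have hg : ∀ i, (g i : 𝓢'(R3, ℂ)) = (f i : 𝓢'(R3, ℂ)) - (S i : 𝓢'(R3, ℂ)) := fun i => by
    rw [← Lp.toTemperedDistribution_toLp_eq (p := 2)]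
    exact map_sub (Lp.toTemperedDistributionCLM ℂ (volume : Measure R3) 2) _ _
  have hgφ : ∀ i φ, ‖(g i : 𝓢'(R3, ℂ)) φ‖ ≤ r * normL2 φ := fun i φ =>
    (norm_apply_le (g i) φ).trans (mul_le_mul_of_nonneg_right (hS i).le (normL2_nonneg _))
  have hSf : ∀ i, (S i : 𝓢'(R3, ℂ)) = (f i : 𝓢'(R3, ℂ)) - (g i : 𝓢'(R3, ℂ)) := fun i => by
    rw [hg, sub_sub_cancel]
  have hdg : ∀ k i φ, ‖hDx h k (g i : 𝓢'(R3, ℂ)) φ‖ ≤ r * normH1 h φ := fun k i φ => by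
    rw [hDx_apply, norm_neg]
    exact (hgφ i _).trans (by gcongr; exact normL2_hDS_le_normH1 h k φ)
  have h1 : ∀ k i φ, ‖pair (hDS h k (S i) - hDS h i (S k)) φ‖ ≤ (α + 2 * r) * normH1 h φ :=
    fun k i φ => by
      have : pair (hDS h k (S i) - hDS h i (S k)) φ =
          (hDx h k (f i : 𝓢'(R3, ℂ)) - hDx h i (f k : 𝓢'(R3, ℂ))) φ -
            (hDx h k (g i : 𝓢'(R3, ℂ)) φ - hDx h i (g k : 𝓢'(R3, ℂ)) φ) := by
        rw [pair_eq_coe, map_sub, ← hDx_toTemperedDistribution, ← hDx_toTemperedDistribution,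
          hSf, hSf, hDx_sub, hDx_sub]
        simp only [_root_.sub_apply]
        ring
      rw [this]
      refine (norm_sub_le _ _).trans ((add_le_add (hcurl k i φ) ((norm_sub_le _ _).trans
        (add_le_add (hdg k i φ) (hdg i k φ)))).trans_eq ?_)
      ring
  have hmulg : ∀ i φ, ‖mulField A (fun j => (g j : 𝓢'(R3, ℂ))) i φ‖ ≤ 3 * M * r * normL2 φ :=
    fun i φ => by
      rw [mulField, _root_.sum_apply]
      refine (norm_sum_le _ _).trans ((Finset.sum_le_sum fun j _ => ?_).trans_eq
        (b := ∑ _j : Fin 3, M * r * normL2 φ) ?_)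
      · rw [TemperedDistribution.smulLeftCLM_apply_apply]
        refine (hgφ j _).trans ?_
        have := normL2_smulLeftCLM_le (hA.growth i j) hM (hA.bound i j) φ
        calc _ ≤ r * (M * normL2 φ) := by gcongr
          _ = _ := by ring
      · simp
        ring
  have h2 : ∀ φ, ‖pair (∑ i, hDS h i (mulFieldS A S i)) φ‖ ≤ (β + 9 * M * r) * normH1 h φ :=
    fun φ => by
      have hmul : ∀ i, ((mulFieldS A S i : 𝓢(R3, ℂ)) : 𝓢'(R3, ℂ)) =
          mulField A (fun j => (f j : 𝓢'(R3, ℂ))) i - mulField A (fun j => (g j : 𝓢'(R3, ℂ))) i :=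
        fun i => by
          rw [← mulField_toTemperedDistribution hA]
          simp only [hSf, mulField, map_sub, Finset.sum_sub_distrib]
      have : pair (∑ i, hDS h i (mulFieldS A S i)) φ =
          (∑ i, hDx h i (mulField A (fun j => (f j : 𝓢'(R3, ℂ))) i)) φ -
            ∑ i, hDx h i (mulField A (fun j => (g j : 𝓢'(R3, ℂ))) i) φ := by
        rw [pair_eq_coe, map_sum]
        simp only [← hDx_toTemperedDistribution, hmul, hDx_sub, _root_.sub_apply,
          _root_.sum_apply, Finset.sum_sub_distrib]
      rw [this]
      refine (norm_sub_le _ _).trans ((add_le_add (hdiv φ) ((norm_sum_le _ _).trans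
        (Finset.sum_le_sum fun i _ => ?_))).trans_eq
          (b := β * normH1 h φ + ∑ _i : Fin 3, 3 * M * r * normH1 h φ) ?_)
      · rw [hDx_apply, norm_neg]
        exact (hmulg i _).trans (by gcongr; exact normL2_hDS_le_normH1 h i φ)
      · simp
        ring
  have h3 : ∀ i φ, ‖pair (S i) φ‖ ≤ (δ + r) * normH1 h φ := fun i φ => by
    rw [pair_eq_coe, hSf, _root_.sub_apply, add_mul]
    exact (norm_sub_le _ _).trans (add_le_add (hf i φ)
      ((hgφ i φ).trans (by gcongr; exact normL2_le_normH1 h φ)))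
  have h4 := sum_normL2_le hc hM hA (by positivity) (by positivity) (by positivity) h1 h2 h3
  have h5 : ∑ i, ‖f i‖ ≤ ∑ i, (normL2 (S i) + r) := Finset.sum_le_sum fun i _ => by
    have := norm_add_le ((S i).toLp 2 volume) (f i - (S i).toLp 2 volume)
    rw [add_sub_cancel] at this
    exact this.trans (add_le_add le_rfl (hS i).le)
  rw [Finset.sum_add_distrib] at h5
  simp only [Finset.sum_const, Finset.card_univ, Fintype.card_fin, nsmul_eq_mul] at h5
  have h6 : η = r * K := by rw [hr]; field_simp
  rw [h6, hK]
  refine h5.trans ((add_le_add h4 le_rfl).trans_eq ?_)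
  push_cast
  ring

/-! ### The dual norm -/

theorem normL2_smul (c : ℂ) (f : 𝓢(R3, ℂ)) : normL2 (c • f) = ‖c‖ * normL2 f := by
  rw [normL2, normL2, ← SchwartzMap.toLpCLM_apply (𝕜 := ℂ), map_smul, norm_smul,
    SchwartzMap.toLpCLM_apply]

theorem normH1_smul (h : ℝ) (c : ℂ) (f : 𝓢(R3, ℂ)) : normH1 h (c • f) = ‖c‖ * normH1 h f := by
  simp only [normH1, map_smul, normL2_smul, mul_add, Finset.mul_sum]

theorem normH1_pos (h : ℝ) {f : 𝓢(R3, ℂ)} (hf : f ≠ 0) : 0 < normH1 h f := by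
  refine lt_of_lt_of_le ?_ (normL2_le_normH1 h f)
  refine norm_pos_iff.2 fun h0 => hf (SchwartzMap.injective_toLp 2 volume ?_)
  change f.toLp 2 volume = SchwartzMap.toLp 0 2 volume
  rw [h0, ← SchwartzMap.toLpCLM_apply (𝕜 := ℝ), map_zero]

theorem recNorm_one_toTemperedDistribution (h : ℝ) (φ : 𝓢(R3, ℂ)) :
    recNorm h 1 (φ : 𝓢'(R3, ℂ)) = ENNReal.ofReal (normH1 h φ) := by
  have h0 : ∀ φ : 𝓢(R3, ℂ), l2Norm (φ : 𝓢'(R3, ℂ)) = ENNReal.ofReal (normL2 φ) := fun φ => by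
    rw [l2Norm_toTemperedDistribution, ← ofReal_norm]
    rfl
  simp only [recNorm, hDx_toTemperedDistribution, h0]
  rw [normH1, ENNReal.ofReal_add (normL2_nonneg φ) (Finset.sum_nonneg fun _ _ => normL2_nonneg _),
    ENNReal.ofReal_sum_of_nonneg fun _ _ => normL2_nonneg _]

/-- The dual norm bounds `T` on all test functions, by homogeneity. -/
theorem norm_apply_le_predNorm_zero {h : ℝ} {T : 𝓢'(R3, ℂ)} (hT : predNorm h 0 T ≠ ⊤)
    (φ : 𝓢(R3, ℂ)) :
    ‖T φ‖ ≤ (multiIndices 3 1).card * (predNorm h 0 T).toReal * normH1 h φ := by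
  by_cases hφ : φ = 0
  · subst hφ
    rw [map_zero, norm_zero, normH1_zero, mul_zero]
  obtain ⟨K, hK⟩ : ∃ K : ℝ, K = (multiIndices 3 1).card := ⟨_, rfl⟩
  rw [← hK]
  have hK0 : 0 < K := by
    rw [hK]
    exact_mod_cast Finset.card_pos.2 ⟨0, mem_multiIndices.2 (by simp)⟩
  have hφ0 := normH1_pos h hφ
  set r : ℝ := K * normH1 h φ with hr
  have hr0 : 0 < r := by positivity
  have h1 : sobolevNormNat h 1 (((r⁻¹ : ℝ) : ℂ) • φ : 𝓢(R3, ℂ)) ≤ 1 := by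
    refine (sobolevNormNat_le_recNorm h 1 _).trans ?_
    rw [recNorm_one_toTemperedDistribution, normH1_smul, Complex.norm_real,
      Real.norm_of_nonneg (by positivity)]
    have h2 : (((multiIndices 3 1).card : ℝ≥0) : ℝ≥0∞) = ENNReal.ofReal K := by
      rw [hK, ENNReal.ofReal_natCast]
      rfl
    rw [h2, ← ENNReal.ofReal_mul hK0.le]
    refine ENNReal.ofReal_le_one.2 (le_of_eq ?_)
    rw [hr]
    field_simp
  have h2 : ‖T (((r⁻¹ : ℝ) : ℂ) • φ)‖ₑ ≤ predNorm h 0 T :=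
    le_iSup₂ (f := fun (φ : 𝓢(R3, ℂ)) (_ : sobolevNormNat h 1 (φ : 𝓢'(R3, ℂ)) ≤ 1) => ‖T φ‖ₑ) _ h1
  have h3 := ENNReal.toReal_mono hT h2
  rw [toReal_enorm, map_smul, norm_smul, Complex.norm_real, Real.norm_of_nonneg (by positivity),
    inv_mul_le_iff₀ hr0] at h3
  refine h3.trans_eq ?_
  rw [hr]
  ring

/-! ### The estimate at all orders -/

/-- The right-hand side of the elliptic estimate of order `m`, namely the norms of order `m - 1` of
`h curl E`, `h div (A E)` and `E`. The curl enters as the antisymmetric matrix with entries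
`h ∂_k E_i - h ∂_i E_k`. -/
noncomputable def ellipticRHS (h : ℝ) (m : ℕ) (A : R3 → Matrix (Fin 3) (Fin 3) ℝ) (E : Field3) :
    ℝ≥0∞ :=
  ∑ k, ∑ i, predNorm h m (hDx h k (E i) - hDx h i (E k)) +
    predNorm h m (∑ i, hDx h i (mulField A E i)) + ∑ j, predNorm h m (E j)

/-- The elliptic estimate of order zero. -/
theorem exists_sum_l2Norm_le {c M : ℝ≥0} (hc : 0 < c) (hM : 0 < M) :
    ∃ C : ℝ≥0, ∀ (h : ℝ) (A : R3 → Matrix (Fin 3) (Fin 3) ℝ), IsElliptic c M A →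
      ∀ E : Field3, (∀ j, l2Norm (E j) ≠ ⊤) → ∑ j, l2Norm (E j) ≤ C * ellipticRHS h 0 A E := by
  obtain ⟨K, hK⟩ : ∃ K : ℝ≥0, K = (multiIndices 3 1).card := ⟨_, rfl⟩
  have hK0 : 0 < K := by
    rw [hK]
    exact_mod_cast Finset.card_pos.2 ⟨0, mem_multiIndices.2 (by simp)⟩
  refine ⟨3 / c * (48 * M + 4) * K, fun h A hA E hE => ?_⟩
  by_cases hX : ellipticRHS h 0 A E = ⊤
  · rw [hX, ENNReal.mul_top (by simpa using ⟨hc.ne', hK0.ne'⟩)]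
    exact le_top
  choose f hf using fun j => exists_coe_eq_of_l2Norm_ne_top (hE j)
  obtain rfl : (fun j => (f j : 𝓢'(R3, ℂ))) = E := funext hf
  set X := ellipticRHS h 0 A (fun j => (f j : 𝓢'(R3, ℂ))) with hXdef
  have hbound : ∀ T : 𝓢'(R3, ℂ), predNorm h 0 T ≤ X → ∀ φ, ‖T φ‖ ≤ K * X.toReal * normH1 h φ :=
    fun T hT φ => by
      refine (norm_apply_le_predNorm_zero (ne_top_of_le_ne_top hX hT) φ).trans ?_
      have := ENNReal.toReal_mono hX hT
      have h0 := normH1_nonneg h φ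
      rw [show ((multiIndices 3 1).card : ℝ) = K by rw [hK, NNReal.coe_natCast]]
      gcongr
  have h1 := sum_norm_le hc hM hA (f := f) (h := h) (α := K * X.toReal) (β := K * X.toReal)
    (δ := K * X.toReal) (by positivity) (by positivity) (by positivity)
    (fun k i => hbound _ ?_) (hbound _ ?_) (fun i => hbound _ ?_)
  · simp only [l2Norm_coe]
    calc ∑ j, ‖f j‖ₑ = ENNReal.ofReal (∑ j, ‖f j‖) := by
          rw [ENNReal.ofReal_sum_of_nonneg fun _ _ => norm_nonneg _]
          simp only [ofReal_norm]
      _ ≤ ENNReal.ofReal ((3 / c * (48 * M + 4) * K : ℝ≥0) * X.toReal) := by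
          refine ENNReal.ofReal_le_ofReal (h1.trans_eq ?_)
          push_cast
          ring
      _ = _ := by
          rw [ENNReal.ofReal_mul (by positivity), ENNReal.ofReal_coe_nnreal,
            ENNReal.ofReal_toReal hX]
  · refine le_trans ?_ (le_self_add.trans le_self_add)
    refine le_trans ?_ (Finset.single_le_sum (f := fun k => ∑ i, predNorm h 0
      (hDx h k (f i : 𝓢'(R3, ℂ)) - hDx h i (f k : 𝓢'(R3, ℂ)))) (fun _ _ => zero_le)
      (Finset.mem_univ k))
    exact Finset.single_le_sum (f := fun i => predNorm h 0
      (hDx h k (f i : 𝓢'(R3, ℂ)) - hDx h i (f k : 𝓢'(R3, ℂ)))) (fun _ _ => zero_le)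
      (Finset.mem_univ i)
  · exact le_add_self.trans le_self_add
  · exact (Finset.single_le_sum (f := fun j => predNorm h 0 (f j : 𝓢'(R3, ℂ)))
      (fun _ _ => zero_le) (Finset.mem_univ i)).trans le_add_self

/-- The distributions `h div (A (h ∂_i E))` and `h ∂_i (h div (A E))` differ by
 `h div ((h ∂_i A) E)`. -/
theorem div_mulField_hDx {c M : ℝ≥0} {A : R3 → Matrix (Fin 3) (Fin 3) ℝ} (hA : IsElliptic c M A)
    (h : ℝ) (i : Fin 3) (E : Field3) :
    ∑ l, hDx h l (mulField A (fun j => hDx h i (E j)) l) =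
      hDx h i (∑ l, hDx h l (mulField A E l)) -
        ∑ l, hDx h l (∑ j, TemperedDistribution.smulLeftCLM ℂ
          (fun x => ((h * fderiv ℝ (fun x => A x l j) x (e i) : ℝ) : ℂ)) (E j)) := by
  rw [hDx_sum, ← Finset.sum_sub_distrib]
  refine Finset.sum_congr rfl fun l _ => ?_
  rw [hDx_comm h i l, ← hDx_sub]
  congr 1
  simp only [mulField, hDx_sum]
  rw [← Finset.sum_sub_distrib]
  refine Finset.sum_congr rfl fun j _ => ?_
  rw [hDx_smulLeftCLM h i (hA.growth l j) (hasTemperateGrowth_fderiv_apply (hA.growth l j) h (e i)),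
    add_sub_cancel_left]

theorem ellipticRHS_hDx_le {c M : ℝ≥0} (hM : 0 < M) {h : ℝ} {m : ℕ}
    {A : R3 → Matrix (Fin 3) (Fin 3) ℝ} (hA : IsElliptic c M A)
    (hb : ∀ i j, CoeffBound h M (m + 1) fun x => A x i j) (i : Fin 3) (E : Field3) :
    ellipticRHS h m A (fun j => hDx h i (E j)) ≤
      (1 + 3 * (7 ^ m * M) : ℝ≥0) * ellipticRHS h (m + 1) A E := by
  have h1 : ∑ k, ∑ l, predNorm h m (hDx h k (hDx h i (E l)) - hDx h l (hDx h i (E k))) ≤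
      ∑ k, ∑ l, predNorm h (m + 1) (hDx h k (E l) - hDx h l (E k)) := by
    refine Finset.sum_le_sum fun k _ => Finset.sum_le_sum fun l _ => ?_
    rw [hDx_comm h k i, hDx_comm h l i, ← hDx_sub]
    exact predNorm_hDx_le h m i _
  have h2 : predNorm h m (∑ l, hDx h l (mulField A (fun j => hDx h i (E j)) l)) ≤
      predNorm h (m + 1) (∑ l, hDx h l (mulField A E l)) +
        (3 * (7 ^ m * M) : ℝ≥0) * ∑ j, predNorm h (m + 1) (E j) := by
    rw [div_mulField_hDx hA]
    refine (predNorm_sub_le h m _ _).trans (add_le_add (predNorm_hDx_le h m i _) ?_)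
    have hterm : ∀ l, predNorm h m (hDx h l (∑ j, TemperedDistribution.smulLeftCLM ℂ
        (fun x => ((h * fderiv ℝ (fun x => A x l j) x (e i) : ℝ) : ℂ)) (E j))) ≤
        (7 ^ m * M : ℝ≥0) * ∑ j, predNorm h (m + 1) (E j) := fun l => by
      rw [hDx_sum, Finset.mul_sum]
      refine (predNorm_sum_le h m _ _).trans (Finset.sum_le_sum fun j _ => ?_)
      exact (predNorm_hDx_le h m l _).trans (recNorm_smulLeftCLM_le hM
        (hasTemperateGrowth_fderiv_apply (hA.growth l j) h (e i)) ((hb l j).2 i) (E j))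
    refine (predNorm_sum_le h m _ _).trans ((Finset.sum_le_sum fun l _ => hterm l).trans_eq ?_)
    simp only [Finset.sum_const, Finset.card_univ, Fintype.card_fin, nsmul_eq_mul]
    push_cast
    ring
  have h3 : ∑ j, predNorm h m (hDx h i (E j)) ≤ ∑ j, predNorm h (m + 1) (E j) :=
    Finset.sum_le_sum fun j _ => predNorm_hDx_le h m i _
  unfold ellipticRHS
  refine (add_le_add (add_le_add h1 h2) h3).trans ?_
  set q : ℝ≥0 := 3 * (7 ^ m * M)
  set X := ∑ k, ∑ l, predNorm h (m + 1) (hDx h k (E l) - hDx h l (E k))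
  set Y := predNorm h (m + 1) (∑ l, hDx h l (mulField A E l))
  set Z := ∑ j, predNorm h (m + 1) (E j)
  calc X + (Y + q * Z) + Z ≤ X + (Y + q * Z) + Z + (q * X + q * Y) := le_self_add
    _ = _ := by
        push_cast
        ring

/-- The elliptic estimate of order `m`, with a constant depending only on `m`, the ellipticity
constant and the bounds for the coefficients. -/
theorem exists_sum_recNorm_le {c M : ℝ≥0} (hc : 0 < c) (hM : 0 < M) (m : ℕ) :
    ∃ C : ℝ≥0, ∀ (h : ℝ) (A : R3 → Matrix (Fin 3) (Fin 3) ℝ), IsElliptic c M A →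
      (∀ i j, CoeffBound h M m fun x => A x i j) →
      ∀ E : Field3, (∀ j, recNorm h m (E j) ≠ ⊤) →
        ∑ j, recNorm h m (E j) ≤ C * ellipticRHS h m A E := by
  induction m with
  | zero =>
    obtain ⟨C, hC⟩ := exists_sum_l2Norm_le hc hM
    exact ⟨C, fun h A hA _ E hE => hC h A hA E hE⟩
  | succ m ih =>
    obtain ⟨C, hC⟩ := ih
    refine ⟨1 + 3 * (C * (1 + 3 * (7 ^ m * M))), fun h A hA hb E hE => ?_⟩
    have h1 : ∀ i, ∑ j, recNorm h m (hDx h i (E j)) ≤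
        (C * (1 + 3 * (7 ^ m * M)) : ℝ≥0) * ellipticRHS h (m + 1) A E := fun i => by
      refine (hC h A hA (fun i j => (hb i j).of_succ) (fun j => hDx h i (E j)) fun j =>
        ne_top_of_le_ne_top (hE j) (recNorm_hDx_le h m i (E j))).trans ?_
      rw [ENNReal.coe_mul, mul_assoc]
      gcongr
      exact ellipticRHS_hDx_le hM hA hb i E
    have h2 : ∑ j, l2Norm (E j) ≤ ellipticRHS h (m + 1) A E :=
      (Finset.sum_le_sum fun j _ => l2Norm_le_recNorm h m (E j)).trans le_add_self
    simp only [recNorm, Finset.sum_add_distrib]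
    rw [Finset.sum_comm]
    refine (add_le_add h2 (Finset.sum_le_sum fun i _ => h1 i)).trans_eq ?_
    simp only [Finset.sum_const, Finset.card_univ, Fintype.card_fin, nsmul_eq_mul]
    push_cast
    ring

/-! ### Passage from the recursive norms to the Sobolev norms -/

theorem smul_curl_apply (h : ℝ) (E : Field3) :
    (h : ℂ) • curl E = ![hDx h 1 (E 2) - hDx h 2 (E 1), hDx h 2 (E 0) - hDx h 0 (E 2),
      hDx h 0 (E 1) - hDx h 1 (E 0)] := by
  funext i
  have hs : ∀ S T : 𝓢'(R3, ℂ), (h : ℂ) • (S - T) = (h : ℂ) • S - (h : ℂ) • T := smul_sub _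
  fin_cases i <;> exact hs _ _

theorem smul_divergence (h : ℝ) (E : Field3) :
    (h : ℂ) • divergence E = ∑ i, hDx h i (E i) := by
  simp only [divergence, hDx, Finset.smul_sum]

theorem sobolevNorm_le_sobolevNormVec (h : ℝ) (s : ℤ) (E : Field3) (j : Fin 3) :
    sobolevNorm h s (E j) ≤ sobolevNormVec h s E :=
  le_rpow_sum_sq Finset.univ (fun j => sobolevNorm h s (E j)) (Finset.mem_univ j)

theorem exists_ellipticRHS_le (m : ℕ) : ∃ C : ℝ≥0, ∀ (h : ℝ)
    (A : R3 → Matrix (Fin 3) (Fin 3) ℝ) (E : Field3), ellipticRHS h m A E ≤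
      C * (sobolevNormVec h ((m : ℤ) - 1) ((h : ℂ) • curl E) +
        sobolevNorm h ((m : ℤ) - 1) ((h : ℂ) • divergence (mulField A E)) +
        sobolevNormVec h ((m : ℤ) - 1) E) := by
  obtain ⟨C, hC⟩ := exists_predNorm_le_sobolevNorm m
  refine ⟨9 * C, fun h A E => ?_⟩
  set X := sobolevNormVec h ((m : ℤ) - 1) ((h : ℂ) • curl E) with hX
  set Y := sobolevNorm h ((m : ℤ) - 1) ((h : ℂ) • divergence (mulField A E)) with hY
  set Z := sobolevNormVec h ((m : ℤ) - 1) E with hZ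
  have hcomp : ∀ l, predNorm h m (((h : ℂ) • curl E) l) ≤ C * X := fun l =>
    (hC h _).trans (by gcongr; exact sobolevNorm_le_sobolevNormVec h _ _ l)
  have hswap : ∀ k i, predNorm h m (hDx h i (E k) - hDx h k (E i)) ≤
      predNorm h m (hDx h k (E i) - hDx h i (E k)) := fun k i => by
    rw [← neg_sub]
    exact predNorm_neg_le h m _
  have h0 := hcomp 0
  have h1 := hcomp 1
  have h2 := hcomp 2
  rw [smul_curl_apply] at h0 h1 h2
  have hdiag : ∀ i, predNorm h m (hDx h i (E i) - hDx h i (E i)) ≤ C * X := fun i => by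
    rw [sub_self, predNorm_zero]
    exact zero_le
  have hX' : ∀ k i, predNorm h m (hDx h k (E i) - hDx h i (E k)) ≤ C * X := fun k i => by
    fin_cases k <;> fin_cases i
    · exact hdiag 0
    · exact h2
    · exact (hswap 2 0).trans h1
    · exact (hswap 0 1).trans h2
    · exact hdiag 1
    · exact h0
    · exact h1
    · exact (hswap 1 2).trans h0
    · exact hdiag 2
  have hXs : ∑ k, ∑ i, predNorm h m (hDx h k (E i) - hDx h i (E k)) ≤ 9 * C * X := by
    refine (Finset.sum_le_sum fun k _ => Finset.sum_le_sum fun i _ => hX' k i).trans_eq ?_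
    simp only [Finset.sum_const, Finset.card_univ, Fintype.card_fin, nsmul_eq_mul]
    push_cast
    ring
  have hYs : predNorm h m (∑ i, hDx h i (mulField A E i)) ≤ C * Y := by
    rw [← smul_divergence]
    exact hC h _
  have hZs : ∑ j, predNorm h m (E j) ≤ 3 * C * Z := by
    refine (Finset.sum_le_sum fun j _ => (hC h (E j)).trans
      (mul_le_mul_right (sobolevNorm_le_sobolevNormVec h _ E j) _)).trans_eq ?_
    simp only [Finset.sum_const, Finset.card_univ, Fintype.card_fin, nsmul_eq_mul]
    push_cast
    ring
  calc ellipticRHS h m A E ≤ 9 * C * X + C * Y + 3 * C * Z := add_le_add (add_le_add hXs hYs) hZs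
    _ ≤ 9 * C * X + C * Y + 3 * C * Z + (8 * C * Y + 6 * C * Z) := le_self_add
    _ = _ := by
        push_cast
        ring

/-- The estimate of the theorem for a single coefficient family. -/
theorem exists_sobolevNormVec_le {A : ℝ → ℝ × R3 → Matrix (Fin 3) (Fin 3) ℝ} (hA : MemCInf A)
    (hpos : UniformlyPosDef A) (m : ℕ) :
    ∃ C : ℝ≥0, ∀ E : Field3, MemHm m E → ∀ t : ℝ, ∀ h ∈ Set.Ioo (0 : ℝ) 1,
      sobolevNormVec h m E ≤ C * (sobolevNormVec h ((m : ℤ) - 1) ((h : ℂ) • curl E) +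
        sobolevNorm h ((m : ℤ) - 1) ((h : ℂ) • divergence (mulField (fun x => A h (t, x)) E)) +
        sobolevNormVec h ((m : ℤ) - 1) E) := by
  obtain ⟨c, hc, hcA⟩ := hpos
  obtain ⟨M, hM, hMA⟩ := hA.exists_coeffBound m
  lift c to ℝ≥0 using hc.le
  obtain ⟨C₁, hC₁⟩ := exists_sum_recNorm_le (c := c) (by exact_mod_cast hc) hM m
  obtain ⟨C₂, hC₂⟩ := exists_ellipticRHS_le m
  refine ⟨((multiIndices 3 m).card : ℕ) * (C₁ * C₂), fun E hE t h hh => ?_⟩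
  have hell : IsElliptic c M fun x => A h (t, x) :=
    ⟨fun i j => hA.hasTemperateGrowth hh t i j, fun i j x => (hMA h hh t i j).abs_le x,
      fun x v => (hcA h hh (t, x)).2 v⟩
  have h1 := hC₁ h _ hell (hMA h hh t) E fun j => recNorm_ne_top_of_memSobolev h m (hE j)
  have h2 : sobolevNormVec h m E ≤ ∑ j, sobolevNormNat h m (E j) :=
    rpow_sum_sq_le_sum Finset.univ fun j => sobolevNormNat h m (E j)
  have h3 : ∑ j, sobolevNormNat h m (E j) ≤
      (((multiIndices 3 m).card : ℕ) : ℝ≥0) * ∑ j, recNorm h m (E j) := by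
    rw [Finset.mul_sum]
    exact Finset.sum_le_sum fun j _ => sobolevNormNat_le_recNorm h m (E j)
  refine h2.trans (h3.trans ?_)
  rw [ENNReal.coe_mul, ENNReal.coe_mul, mul_assoc, mul_assoc]
  gcongr
  refine h1.trans ?_
  gcongr
  exact hC₂ h _ E

end Semiclassical

theorem theorem3p1
    (ε μ : ℝ → ℝ × R3 → Matrix (Fin 3) (Fin 3) ℝ)
    (hε : MemCInf ε) (hμ : MemCInf μ)
    (hεpos : UniformlyPosDef ε) (hμpos : UniformlyPosDef μ) (m : ℕ) :
    ∃ C : ℝ≥0, ∀ E B : Field3, MemHm m E → MemHm m B →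
      ∀ t : ℝ, ∀ h ∈ Set.Ioo (0 : ℝ) 1,
        sobolevNormVec h m E ≤
            C * (sobolevNormVec h ((m : ℤ) - 1) ((h : ℂ) • curl E)
              + sobolevNorm h ((m : ℤ) - 1)
                  ((h : ℂ) • divergence (mulField (fun x => ε h (t, x)) E))
              + sobolevNormVec h ((m : ℤ) - 1) E) ∧
        sobolevNormVec h m B ≤
            C * (sobolevNormVec h ((m : ℤ) - 1) ((h : ℂ) • curl B)
              + sobolevNorm h ((m : ℤ) - 1)
                  ((h : ℂ) • divergence (mulField (fun x => μ h (t, x)) B))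
              + sobolevNormVec h ((m : ℤ) - 1) B) := by
  obtain ⟨C₁, h₁⟩ := exists_sobolevNormVec_le hε hεpos m
  obtain ⟨C₂, h₂⟩ := exists_sobolevNormVec_le hμ hμpos m
  refine ⟨max C₁ C₂, fun E B hE hB t h hh => ⟨(h₁ E hE t h hh).trans ?_, (h₂ B hB t h hh).trans ?_⟩⟩
  · gcongr
    exact le_max_left _ _
  · gcongr
    exact le_max_right _ _
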